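/- Let $d\in\{2,3\}$ and let $\Omega\subset\mathbb R^d$ be a closed cube with side length $\ell>0$, identified with the $d$-dimensional torus; functions on $\Omega$ are understood to be $\Omega$-periodic, i.e. $\ell\mathbb Z^d$-periodic on $\mathbb R^d$. Write $\langle u,v\rangle=\int_\Omega u\cdot v\,dx$. Assume: (i) $\gamma_\rho,\gamma_\eta>0$ are constants; (ii) for every $\omega=(\rho,\eta,p,q)\in\mathbb R\times\mathbb R\times\mathbb R^d\times\mathbb R^d$ the matrix $\mathbf L(\omega)=\begin{pmatrix}\mathbf L_{11}&\mathbf L_{12}\\ \mathbf L_{12}^\top&\mathbf L_{22}\end{pmatrix}(\omega)\in\mathbb R^{(d+1)\times(d+1)}$ (with $\mathbf L_{11}\in\mathbb R^{d\times d}$, $\mathbf L_{12}\in\mathbb R^d$, $\mathbf L_{22}\in\mathbb R$) is symmetric, there are constants $\lambda_1>0$ and $\lambda_2$ with $\lambda_1|\xi|^2\le\xi^\top\mathbf L(\omega)\xi\le\lambda_2|\xi|^2$ for all $\xi\in\mathbb R^{d+1}$ and all $\omega$, and the entries of $\mathbf L$ are $C^2$ functions of $\omega$ whose first and second derivatives are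 uniformly bounded; (iii) $f:\mathbb R^2\to[0,\infty)$ is of class $C^4$, there are constants $C_1,C_2$ such that $\bigl|\partial_\rho^k\partial_\eta^l f(\rho,\eta)\bigr|\le C_1\bigl(|\rho|^{4-k}+|\eta|^{4-l}\bigr)+C_2$ for all $\rho,\eta\in\mathbb R$ and all integers $k,l\ge0$ with $k+l\le4$, and $f(\rho,\eta)+\frac\alpha2(|\rho|^2+|\eta|^2)$ is strictly convex for some $\alpha>0$. Write $f_\rho=\partial_\rho f$, $f_\eta=\partial_\eta f$; (iv) $\mathcal T_h$ is a finite, geometrically conforming partition of $\Omega$ into non-degenerate closed simplices whose $\ell\mathbb Z^d$-periodic extension is geometrically conforming too; it is quasi-uniform with mesh size $h>0$, i.e. $h$ is the largest diameter of a simplex and, for some $\sigma>0$, the inner-circle radius $\rho_K$ (the supremum of the radii of balls contained in $K$) satisfies $\rho_K\ge\sigma h$ for every $K\in\mathcal T_h$; (v) $T>0$, $N\ge1$ is an integer, $\tau=T/N$, $t^n=n\tau$ and $I_n=(t^{n-1},t^n)$. Let $\mathcal V_h$ be the space of continuous $\Omega$-periodic functions that coincide on each $K\in\mathcal T_h$ with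 a polynomial of degree at most $2$. Let $P_k(\mathcal I_\tau;\mathcal V_h)$ denote the functions of time with values in $\mathcal V_h$ that are polynomials of degree at most $k$ in $t$ on each $I_n$, let $P_k^c(\mathcal I_\tau;\mathcal V_h)$ be the subspace of those that are continuous on $[0,T]$, let $\langle a,b\rangle^n=\int_{I_n}\langle a(s),b(s)\rangle\,ds$, and let a bar over a function of time denote its $L^2$-orthogonal projection to functions that are constant on each $I_n$ (its average over each $I_n$). For $\rho,\eta\in P_1^c(\mathcal I_\tau;\mathcal V_h)$ put $\omega=(\rho,\eta,\nabla\rho,\nabla\eta)$. Fully discrete scheme: given $\rho_{h,0},\eta_{h,0}\in\mathcal V_h$, find $\rho,\eta\in P_1^c(\mathcal I_\tau;\mathcal V_h)$ and $\mu_\rho,\mu_\eta\in P_0(\mathcal I_\tau;\mathcal V_h)$ with $\rho(0)=\rho_{h,0}$, $\eta(0)=\eta_{h,0}$ such that, for all $1\le n\le N$ and all $v_1,v_2,w_1,w_2\in\mathcal V_h$ (test functions constant in time on $I_n$), $$\langle\partial_t\rho,v_1\rangle^n+\langle\mathbf L_{11}(\bar\omega)\nabla\mu_\rho+\mu_\eta\mathbf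 L_{12}(\bar\omega),\nabla v_1\rangle^n=0,$$ $$\langle\partial_t\eta,v_2\rangle^n+\langle\mathbf L_{12}(\bar\omega)\cdot\nabla\mu_\rho+\mathbf L_{22}(\bar\omega)\mu_\eta,v_2\rangle^n=0,$$ $$\langle\mu_\rho,w_1\rangle^n-\gamma_\rho\langle\nabla\bar\rho,\nabla w_1\rangle^n-\langle f_\rho(\rho,\eta),w_1\rangle^n=0,$$ $$\langle\mu_\eta,w_2\rangle^n-\gamma_\eta\langle\nabla\bar\eta,\nabla w_2\rangle^n-\langle f_\eta(\rho,\eta),w_2\rangle^n=0.$$ Theorem. Under these assumptions, for any $h,\tau>0$ and any $\rho_{h,0},\eta_{h,0}\in\mathcal V_h$, the fully discrete scheme has at least one solution. Moreover, every solution conserves mass, i.e. $\frac{d}{dt}\int_\Omega\rho(t)\,dx=0$, and hence $\int_\Omega\rho(t)\,dx=\int_\Omega\rho_{h,0}\,dx$, on $[0,T]$, and for every $1\le n\le N$ it satisfies $$\mathcal E(\rho(t^n),\eta(t^n))-\mathcal E(\rho(t^{n-1}),\eta(t^{n-1}))=-\int_{I_n}\mathcal D_{\bar\rho,\bar\eta}(\mu_\rho,\mu_\eta)\,ds,$$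 where $\mathcal E(\rho,\eta)=\int_\Omega\frac{\gamma_\rho}2|\nabla\rho|^2+\frac{\gamma_\eta}2|\nabla\eta|^2+f(\rho,\eta)\,dx$ and $$\mathcal D_{\rho,\eta}(\mu_\rho,\mu_\eta)=\int_\Omega\begin{pmatrix}\nabla\mu_\rho\\ \mu_\eta\end{pmatrix}^{\!\top}\mathbf L(\rho,\eta,\nabla\rho,\nabla\eta)\begin{pmatrix}\nabla\mu_\rho\\ \mu_\eta\end{pmatrix}dx.$$ -/

import Mathlib

open MeasureTheory Set
open scoped Matrix

noncomputable section

namespace CHAC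

/-- Points of `ℝᵈ` with the Euclidean norm. -/
abbrev E (d : ℕ) : Type := EuclideanSpace ℝ (Fin d)

/-- Arguments `ω = (ρ, η, ∇ρ, ∇η)` of the mobility matrix. -/
abbrev State (d : ℕ) : Type := ℝ × ℝ × E d × E d

/-- The data of the model: interface parameters, mobility matrix `L` of size `(d+1) × (d+1)`
(indexed by `Fin d ⊕ Unit`, so that its blocks are `L₁₁, L₁₂, L₁₂ᵀ, L₂₂`), and potential. -/
structure Model (d : ℕ) where
  gammaRho : ℝ
  gammaEta : ℝ
  L : State d → Matrix (Fin d ⊕ Unit) (Fin d ⊕ Unit) ℝ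
  f : ℝ → ℝ → ℝ

namespace Model

variable {d : ℕ} (M : Model d)

/-- The block `L₁₁(ω)`, acting on vectors. -/
def L11 (w : State d) (y : E d) : E d :=
  WithLp.toLp 2 ((M.L w).toBlocks₁₁ *ᵥ y.ofLp)

/-- The block `L₁₂(ω)`, a vector. -/
def L12 (w : State d) : E d :=
  WithLp.toLp 2 (fun i => M.L w (Sum.inl i) (Sum.inr ()))

/-- The block `L₂₂(ω)`, a number. -/
def L22 (w : State d) : ℝ := M.L w (Sum.inr ()) (Sum.inr ())

/-- The partial derivative `∂f/∂ρ`. -/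
def fRho (r e : ℝ) : ℝ := deriv (fun r' => M.f r' e) r

/-- The partial derivative `∂f/∂η`. -/
def fEta (r e : ℝ) : ℝ := deriv (fun e' => M.f r e') e

/-- The interface parameters are positive. -/
structure PosInterface : Prop where
  gammaRho_pos : 0 < M.gammaRho
  gammaEta_pos : 0 < M.gammaEta

/-- The mobility matrix is symmetric, uniformly positive definite and uniformly bounded, and its
entries are of class `C²` with uniformly bounded first and second derivatives. -/
structure GoodMobility : Prop where
  symm : ∀ w, (M.L w).IsSymm
  bounds : ∃ lam1 lam2 : ℝ, 0 < lam1 ∧ ∀ (w : State d) (xi : Fin d ⊕ Unit → ℝ),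
    lam1 * (xi ⬝ᵥ xi) ≤ xi ⬝ᵥ (M.L w *ᵥ xi) ∧ xi ⬝ᵥ (M.L w *ᵥ xi) ≤ lam2 * (xi ⬝ᵥ xi)
  contDiff : ∀ i j, ContDiff ℝ 2 (fun w => M.L w i j)
  deriv_bounds : ∃ lam3 : ℝ, ∀ i j, ∀ k ∈ ({1, 2} : Set ℕ), ∀ w,
    ‖iteratedFDeriv ℝ k (fun w' => M.L w' i j) w‖ ≤ lam3

/-- The potential is non-negative, of class `C⁴`, with derivatives of polynomial growth, and
becomes strictly convex after a quadratic shift. -/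
structure GoodPotential : Prop where
  contDiff : ContDiff ℝ 4 (fun p : ℝ × ℝ => M.f p.1 p.2)
  nonneg : ∀ r e, 0 ≤ M.f r e
  growth : ∃ C1 C2 : ℝ, ∀ k l : ℕ, k + l ≤ 4 → ∀ r e : ℝ,
    |iteratedDeriv k (fun r' => iteratedDeriv l (fun e' => M.f r' e') e) r|
      ≤ C1 * (|r| ^ (4 - k) + |e| ^ (4 - l)) + C2
  shifted_convex : ∃ α : ℝ, 0 < α ∧
    StrictConvexOn ℝ univ (fun p : ℝ × ℝ => M.f p.1 p.2 + α / 2 * (|p.1| ^ 2 + |p.2| ^ 2))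

end Model

/-- The data of the domain and of the discretization: the cube `a + [0, ℓ]ᵈ`, the simplices of the
triangulation (each given by its set of vertices), the final time `T`, and the number `N` of
time steps. -/
structure Grid (d : ℕ) where
  corner : E d
  side : ℝ
  cells : Finset (Finset (E d))
  T : ℝ
  N : ℕ

/-- The closed simplex with vertex set `K`. -/
def simplex {d : ℕ} (K : Finset (E d)) : Set (E d) := convexHull ℝ (K : Set (E d))

/-- The inner-circle radius `ρ_K` of the simplex with vertex set `K`. -/
def inradius {d : ℕ} (K : Finset (E d)) : ℝ :=
  sSup {r : ℝ | 0 ≤ r ∧ ∃ x, Metric.closedBall x r ⊆ simplex K}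

namespace Grid

variable {d : ℕ} (G : Grid d)

/-- The (closed) cube `Ω`. -/
def Om : Set (E d) := {x | ∀ i, x i ∈ Icc (G.corner i) (G.corner i + G.side)}

/-- The period vector `ℓ z`, for `z ∈ ℤᵈ`. -/
def period (z : Fin d → ℤ) : E d := WithLp.toLp 2 (fun i => G.side * (z i : ℝ))

/-- Being a geometrically conforming, quasi-uniform partition of `Ω` into simplices, with global
mesh size `h`, whose periodic extension is geometrically conforming as well. -/
structure IsMesh (h : ℝ) : Prop where
  card_vertices : ∀ K ∈ G.cells, K.card = d + 1
  nondegenerate : ∀ K ∈ G.cells, AffineIndependent ℝ ((↑) : K → E d)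
  cover : (⋃ K ∈ G.cells, simplex K) = G.Om
  /-- A simplex and any periodic translate of a simplex meet in the convex hull of their
  common vertices, that is, in a common face or not at all; `z = 0` is conformity on `Ω`. -/
  conforming : ∀ K ∈ G.cells, ∀ K' ∈ G.cells, ∀ z : Fin d → ℤ,
    simplex K ∩ (fun x => x + G.period z) '' simplex K'
      ⊆ convexHull ℝ ((K : Set (E d)) ∩ (fun x => x + G.period z) '' (K' : Set (E d)))
  mesh_size : IsGreatest {r : ℝ | ∃ K ∈ G.cells, r = Metric.diam (simplex K)} h
  quasi_uniform : ∃ σ : ℝ, 0 < σ ∧ ∀ K ∈ G.cells, σ * h ≤ inradius K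

/-- The finite element space `V_h` of continuous, `Ω`-periodic functions that are polynomials of
degree at most two on each simplex. -/
def Vh : Submodule ℝ (E d → ℝ) where
  carrier := {v | Continuous v ∧ (∀ x z, v (x + G.period z) = v x) ∧
    ∀ K ∈ G.cells, ∃ p : MvPolynomial (Fin d) ℝ, p.totalDegree ≤ 2 ∧
      ∀ x ∈ simplex K, v x = MvPolynomial.eval (fun i => x i) p}
  zero_mem' := ⟨continuous_const, fun _ _ => rfl, fun _ _ => ⟨0, by simp, by simp⟩⟩
  add_mem' := by
    rintro u v ⟨hu, hu', hu''⟩ ⟨hv, hv', hv''⟩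
    refine ⟨hu.add hv, fun x z => by simp [hu', hv'], fun K hK => ?_⟩
    obtain ⟨p, hp, hp'⟩ := hu'' K hK
    obtain ⟨q, hq, hq'⟩ := hv'' K hK
    exact ⟨p + q, (MvPolynomial.totalDegree_add p q).trans (max_le hp hq),
      fun x hx => by simp [hp' x hx, hq' x hx]⟩
  smul_mem' := by
    rintro c v ⟨hv, hv', hv''⟩
    refine ⟨hv.const_smul c, fun x z => by simp [hv'], fun K hK => ?_⟩
    obtain ⟨p, hp, hp'⟩ := hv'' K hK
    exact ⟨c • p, (MvPolynomial.totalDegree_smul_le c p).trans hp,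
      fun x hx => by simp [hp' x hx, MvPolynomial.smul_eval]⟩

/-- The time step size `τ = T / N`. -/
def tau : ℝ := G.T / G.N

/-- The grid points `tⁿ = n τ`. -/
def t (n : ℕ) : ℝ := n * G.tau

/-- The space `P_k(𝓘_τ; X)` of piecewise polynomials of degree at most `k` in time
(only the values on the time interval `[0, T]` matter). -/
def IsPiecewisePoly {X : Type*} [AddCommGroup X] [Module ℝ X] (k : ℕ) (u : ℝ → X) : Prop :=
  ∀ n ∈ Finset.Icc 1 G.N, ∃ c : Fin (k + 1) → X, ∀ s ∈ Ioo (G.t (n - 1)) (G.t n),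
    u s = ∑ j : Fin (k + 1), s ^ (j : ℕ) • c j

/-- The space `P_kᶜ(𝓘_τ; X)` of continuous piecewise polynomials in time. For `X = V_h`, the
topology is that of pointwise convergence, the only Hausdorff vector space topology there, as
`V_h` has finite dimension. -/
def IsContPiecewisePoly {X : Type*} [AddCommGroup X] [Module ℝ X] [TopologicalSpace X]
    (k : ℕ) (u : ℝ → X) : Prop :=
  G.IsPiecewisePoly k u ∧ ContinuousOn u (Icc 0 G.T)

/-- The value on `I_n = (tⁿ⁻¹, tⁿ)` of the `L²`-orthogonal projection of `g` to piecewise constants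
in time: the average of `g` over `I_n`. -/
def timeAvg {F : Type*} [NormedAddCommGroup F] [NormedSpace ℝ F] (n : ℕ) (g : ℝ → F) : F :=
  G.tau⁻¹ • ∫ s in G.t (n - 1)..G.t n, g s

/-- The pairing `⟨a, b⟩ⁿ`, the integral of `a · b` over `I_n × Ω`, where `ab` is the product
`(s, x) ↦ a(s, x) · b(s, x)`. -/
def stInt (n : ℕ) (ab : ℝ → E d → ℝ) : ℝ :=
  ∫ s in G.t (n - 1)..G.t n, ∫ x in G.Om, ab s x

/-- The time derivative `∂ₜ u` of a function with values in `V_h`. -/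
def dt (u : ℝ → G.Vh) (s : ℝ) (x : E d) : ℝ := deriv (fun s' => (u s' : E d → ℝ) x) s

/-- The value on `I_n` of the projection of `u` to piecewise constants in time. -/
def bar (u : ℝ → G.Vh) (n : ℕ) (x : E d) : ℝ := G.timeAvg n (fun s => (u s : E d → ℝ) x)

/-- The value on `I_n` of the projection of `∇u` to piecewise constants in time. -/
def barGrad (u : ℝ → G.Vh) (n : ℕ) (x : E d) : E d :=
  G.timeAvg n (fun s => gradient (u s : E d → ℝ) x)

/-- The value on `I_n` of the projection of `ω = (ρ, η, ∇ρ, ∇η)` to piecewise constants in time. -/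
def barState (ρ η : ℝ → G.Vh) (n : ℕ) (x : E d) : State d :=
  (G.bar ρ n x, G.bar η n x, G.barGrad ρ n x, G.barGrad η n x)

variable (M : Model d)

/-- The fully discrete scheme with initial values `ρ0, η0`. Functions that are constant in time on
`I_n` with values in `V_h`, the test functions, are given by their value. -/
structure IsSolution (ρ0 η0 : G.Vh) (ρ η μρ μη : ℝ → G.Vh) : Prop where
  rho_space : G.IsContPiecewisePoly 1 ρ
  eta_space : G.IsContPiecewisePoly 1 η
  muRho_space : G.IsPiecewisePoly 0 μρ
  muEta_space : G.IsPiecewisePoly 0 μη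
  rho_init : ρ 0 = ρ0
  eta_init : η 0 = η0
  eq1 : ∀ n ∈ Finset.Icc 1 G.N, ∀ v : G.Vh,
    G.stInt n (fun s x => G.dt ρ s x * v.1 x)
      + G.stInt n (fun s x => inner ℝ
          (M.L11 (G.barState ρ η n x) (gradient (μρ s).1 x)
            + (μη s).1 x • M.L12 (G.barState ρ η n x))
          (gradient v.1 x)) = 0
  eq2 : ∀ n ∈ Finset.Icc 1 G.N, ∀ v : G.Vh,
    G.stInt n (fun s x => G.dt η s x * v.1 x)
      + G.stInt n (fun s x =>
          (inner ℝ (M.L12 (G.barState ρ η n x)) (gradient (μρ s).1 x)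
            + M.L22 (G.barState ρ η n x) * (μη s).1 x) * v.1 x) = 0
  eq3 : ∀ n ∈ Finset.Icc 1 G.N, ∀ w : G.Vh,
    G.stInt n (fun s x => (μρ s).1 x * w.1 x)
      - M.gammaRho * G.stInt n (fun _ x => inner ℝ (gradient (G.bar ρ n) x) (gradient w.1 x))
      - G.stInt n (fun s x => M.fRho ((ρ s).1 x) ((η s).1 x) * w.1 x) = 0
  eq4 : ∀ n ∈ Finset.Icc 1 G.N, ∀ w : G.Vh,
    G.stInt n (fun s x => (μη s).1 x * w.1 x)
      - M.gammaEta * G.stInt n (fun _ x => inner ℝ (gradient (G.bar η n) x) (gradient w.1 x))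
      - G.stInt n (fun s x => M.fEta ((ρ s).1 x) ((η s).1 x) * w.1 x) = 0

/-- The total free energy. -/
def energy (ρ η : E d → ℝ) : ℝ :=
  ∫ x in G.Om, M.gammaRho / 2 * ‖gradient ρ x‖ ^ 2 + M.gammaEta / 2 * ‖gradient η x‖ ^ 2
    + M.f (ρ x) (η x)

/-- The vector `(∇μ_ρ, μ_η)` at a point. -/
def forces (μρ μη : E d → ℝ) (x : E d) : Fin d ⊕ Unit → ℝ :=
  Sum.elim (fun i => gradient μρ x i) (fun _ => μη x)

/-- The dissipation functional, the integral over `Ω` of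
`(∇μ_ρ, μ_η)ᵀ L(ρ, η, ∇ρ, ∇η) (∇μ_ρ, μ_η)`. -/
def dissipation (ρ η μρ μη : E d → ℝ) : ℝ :=
  ∫ x in G.Om, forces μρ μη x ⬝ᵥ
    (M.L (ρ x, η x, gradient ρ x, gradient η x) *ᵥ forces μρ μη x)

end Grid

end CHAC

end

open CHAC

/-! On each interval `I_n` the fields `ρ, η` are affine in time, so every time integral in the
scheme is explicit: averages become midpoints, `∂ₜ` becomes a difference quotient, and the nonlinear
terms become `τ` times the mean of `f_ρ` or `f_η` over the segment from old to new values
(`segAvg`). One step is thus a system for six finite element functions, `IsStep`;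
`HasFields.isStep_iff` is the dictionary.

The segment means obey the exact chain rule `GoodPotential.sub_eq_segAvg`. Testing the four
equations with `μ_ρ`, `μ_η`, `ρ¹ - ρ⁰`, `η¹ - η⁰` makes the products of potentials with increments
cancel and leaves `τ` times the dissipation plus the energy increment (`forms_sum_eq`). This is the
energy identity of every solution; testing the mass balance with the constant one gives conservation
of mass.

For existence the same identity serves as an a priori bound. The dissipation controls `∇μ_ρ` and
`μ_η`, the energy controls `∇ρ¹` and `∇η¹`; since `f` is merely bounded below, the means of `ρ¹`,
`η¹` and `μ_ρ` escape. Those of `ρ¹ - ρ⁰` and `μ_ρ` are normalized to zero, and `η¹` is recovered by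
adding a small multiple of `η¹ - η⁰` to the test function `μ_η` (`residual_coercive`). A coercive
continuous system in finite dimension has a zero (`exists_zero_of_coercive`), which rests on the
no-retraction theorem, proved here by the volume polynomial argument of Milnor and Rogers. A
constant added to `μ_ρ` then removes the restriction to mean-free test functions (`exists_isStep`),
and the steps are glued in time by `interpolation`. -/

section NoRetraction

/-! ### No-retraction theorem and zeros of coercive maps. -/

open Polynomial Metric Module

variable {E : Type*} [NormedAddCommGroup E] [InnerProductSpace ℝ E] [FiniteDimensional ℝ E]

/-- `det (B + t A)` is a polynomial in `t` of degree at most the dimension, hence equal to its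
interpolant at any larger set of nodes; evaluate at `t = 1`. -/
theorem det_add_eq_sum_lagrange (A B : E →L[ℝ] E) (s : Finset ℝ) (hs : finrank ℝ E < s.card) :
    (B + A).det = ∑ i ∈ s, (B + i • A).det * (Lagrange.basis s id i).eval 1 := by
  classical
  let b := stdOrthonormalBasis ℝ E
  let m := LinearMap.toMatrix b.toBasis b.toBasis
  let P : ℝ[X] := Matrix.det ((X : ℝ[X]) • (m A).map C + (m B).map C)
  have hP : ∀ t : ℝ, P.eval t = (B + t • A).det := by
    intro t
    have h1 : P.eval t = Matrix.det (t • m A + m B) := by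
      have h := RingHom.map_det (evalRingHom t) ((X : ℝ[X]) • (m A).map C + (m B).map C)
      rw [coe_evalRingHom] at h
      rw [h]
      congr 1
      ext i j
      simp
      exact mul_comm _ _
    rw [h1, ContinuousLinearMap.det, ← LinearMap.det_toMatrix b.toBasis]
    congr 1
    simp [m, add_comm]
  have hdeg : P.degree < s.card := by
    refine lt_of_le_of_lt degree_le_natDegree ?_
    have := natDegree_det_X_add_C_le (m A) (m B)
    rw [Fintype.card_fin] at this
    exact_mod_cast lt_of_le_of_lt this hs
  have hL := Lagrange.eq_interpolate (f := P) (s := s) (v := id) (injOn_id _) hdeg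
  have h1 := hP 1
  rw [one_smul] at h1
  rw [← h1, hL, Lagrange.interpolate_apply, eval_finsetSum]
  refine Finset.sum_congr rfl fun i _ => ?_
  simp [← hP]

/-- No operator `id + t A` with `0 ≤ t ≤ 1` has a kernel, since a kernel vector would satisfy `‖v‖ ≤
‖A‖ ‖v‖`; so the determinant keeps the sign it has at `t = 0`. -/
theorem det_id_add_pos (A : E →L[ℝ] E) (hA : ‖A‖ < 1) :
    0 < (ContinuousLinearMap.id ℝ E + A).det := by
  have hne : ∀ t ∈ Icc (0 : ℝ) 1, (ContinuousLinearMap.id ℝ E + t • A).det ≠ 0 := by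
    intro t ht h0
    have h0' : LinearMap.det ((ContinuousLinearMap.id ℝ E + t • A : E →L[ℝ] E) : E →ₗ[ℝ] E) = 0 :=
      h0
    obtain ⟨v, hv, hv0⟩ := Submodule.exists_mem_ne_zero_of_ne_bot
      (LinearMap.bot_lt_ker_of_det_eq_zero h0').ne'
    have h1 : v + t • A v = 0 := by simpa using hv
    have h2 : v = -(t • A v) := eq_neg_of_add_eq_zero_left h1
    have h3 : ‖v‖ ≤ ‖A‖ * ‖v‖ := by
      calc ‖v‖ = ‖t • A v‖ := by rw [h2, norm_neg, ← h2]
        _ = t * ‖A v‖ := by rw [norm_smul, Real.norm_of_nonneg ht.1]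
        _ ≤ 1 * ‖A v‖ := by gcongr; exact ht.2
        _ ≤ ‖A‖ * ‖v‖ := by rw [one_mul]; exact A.le_opNorm v
    have : 0 < ‖v‖ := norm_pos_iff.2 hv0
    nlinarith
  by_contra hneg
  push Not at hneg
  have hc : Continuous fun t : ℝ => (ContinuousLinearMap.id ℝ E + t • A).det :=
    ContinuousLinearMap.continuous_det.comp (by fun_prop)
  have := intermediate_value_Icc' (zero_le_one' ℝ) hc.continuousOn
  obtain ⟨t, ht, h0⟩ := this ⟨by simpa using hneg, by
    simp only [zero_smul, add_zero]
    rw [ContinuousLinearMap.det, ContinuousLinearMap.coe_id, LinearMap.det_id]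
    exact zero_le_one⟩
  exact hne t ht h0

variable [MeasurableSpace E] [BorelSpace E]

/-- For small `t` the map `x + t (f x - x)` is a bijection of the open ball with positive Jacobian,
so the change of variables formula computes the volume of the ball. -/
theorem integral_det_homotopy_eq_volume_ball {f : E → E} (hf : ContDiff ℝ 1 f)
    (hf1 : ∀ x, ‖f x‖ = 1) (hfs : ∀ x, ‖x‖ = 1 → f x = x) {C : NNReal}
    (hC : ∀ x ∈ closedBall (0 : E) 1, ‖fderiv ℝ f x - ContinuousLinearMap.id ℝ E‖₊ ≤ C)
    {t : ℝ} (ht0 : 0 ≤ t) (ht1 : t < 1) (htC : t * C < 1) :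
    ∫ x in ball (0 : E) 1, (ContinuousLinearMap.id ℝ E +
      t • (fderiv ℝ f x - ContinuousLinearMap.id ℝ E)).det
      = (volume (ball (0 : E) 1)).toReal := by
  set g : E → E := fun x => x + t • (f x - x) with hg
  set g' : E → E →L[ℝ] E := fun x => ContinuousLinearMap.id ℝ E +
      t • (fderiv ℝ f x - ContinuousLinearMap.id ℝ E) with hg'
  have hfd : ∀ x, HasStrictFDerivAt f (fderiv ℝ f x) x := fun x =>
    hf.contDiffAt.hasStrictFDerivAt one_ne_zero
  have hgd : ∀ x, HasStrictFDerivAt g (g' x) x := fun x =>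
    (hasStrictFDerivAt_id x).add (((hfd x).sub (hasStrictFDerivAt_id x)).const_smul t)
  have hgc : Continuous g := by
    have := hf.continuous
    fun_prop
  have hpos : ∀ x ∈ closedBall (0 : E) 1, 0 < (g' x).det := by
    intro x hx
    apply det_id_add_pos
    rw [norm_smul, Real.norm_of_nonneg ht0]
    refine lt_of_le_of_lt ?_ htC
    gcongr
    exact hC x hx
  have hlip : LipschitzOnWith C (fun x => f x - x) (closedBall (0 : E) 1) := by
    refine (convex_closedBall 0 1).lipschitzOnWith_of_nnnorm_hasFDerivWithin_le
      (fun x _ => ((hfd x).hasFDerivAt.sub (hasFDerivAt_id x)).hasFDerivWithinAt) hC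
  -- `g` differs from the identity by a map with Lipschitz constant `t C < 1`.
  have hinj : InjOn g (closedBall (0 : E) 1) := by
    intro x hx y hy hxy
    by_contra hne
    have h1 : x - y = t • ((f y - y) - (f x - x)) := by
      have : x + t • (f x - x) = y + t • (f y - y) := hxy
      rw [smul_sub, sub_eq_sub_iff_add_eq_add, this, add_comm]
    have h2 : ‖x - y‖ ≤ t * (C * ‖x - y‖) := by
      have h3 := hlip.dist_le_mul y hy x hx
      rw [dist_eq_norm, dist_eq_norm, norm_sub_rev y x] at h3
      calc ‖x - y‖ = t * ‖(f y - y) - (f x - x)‖ := by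
            conv_lhs => rw [h1, norm_smul, Real.norm_of_nonneg ht0]
        _ ≤ _ := by gcongr
    have : 0 < ‖x - y‖ := norm_pos_iff.2 (sub_ne_zero.2 hne)
    nlinarith
  have hmaps : ∀ x ∈ ball (0 : E) 1, g x ∈ ball (0 : E) 1 := by
    intro x hx
    rw [mem_ball_zero_iff] at hx ⊢
    have : g x = (1 - t) • x + t • f x := by simp only [hg]; module
    calc ‖g x‖ ≤ ‖(1 - t) • x‖ + ‖t • f x‖ := by rw [this]; exact norm_add_le _ _
      _ = (1 - t) * ‖x‖ + t * 1 := by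
        rw [norm_smul, norm_smul, hf1, Real.norm_of_nonneg ht0,
          Real.norm_of_nonneg (sub_nonneg.2 ht1.le)]
      _ < 1 := by nlinarith
  have himage : g '' ball (0 : E) 1 = ball (0 : E) 1 := by
    refine Subset.antisymm (image_subset_iff.2 hmaps) ?_
    -- The image of the open ball is open because the derivative is invertible. Inside the ball it
    -- agrees with the compact image of the closed ball, as the sphere is fixed pointwise; being
    -- open and relatively closed, it fills the connected ball.
    have hopen : IsOpen (g '' ball (0 : E) 1) := by
      rw [isOpen_iff_mem_nhds]
      rintro _ ⟨x, hx, rfl⟩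
      have hsurj : (g' x).range = ⊤ := by
        have hu : IsUnit (LinearMap.det ((g' x : E →L[ℝ] E) : E →ₗ[ℝ] E)) :=
          isUnit_iff_ne_zero.2 (hpos x (ball_subset_closedBall hx)).ne'
        exact LinearMap.range_eq_top.2
          ((Module.End.isUnit_iff _).1 ((LinearMap.isUnit_iff_isUnit_det _).2 hu)).2
      rw [← (hgd x).map_nhds_eq_of_surj hsurj]
      exact Filter.image_mem_map (isOpen_ball.mem_nhds hx)
    have hcl : IsClosed (g '' closedBall (0 : E) 1) :=
      ((isCompact_closedBall 0 1).image hgc).isClosed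
    have h0 : (0 : E) ∈ ball (0 : E) 1 := by simp
    refine (convex_ball (0 : E) 1).isPreconnected.subset_left_of_subset_union hopen
      hcl.isOpen_compl ?_ ?_ ⟨g 0, hmaps 0 h0, mem_image_of_mem g h0⟩
    · exact disjoint_compl_right_iff_subset.2 (image_mono ball_subset_closedBall)
    · intro y hy
      by_cases hyc : y ∈ g '' closedBall (0 : E) 1
      · left
        obtain ⟨x, hx, rfl⟩ := hyc
        refine ⟨x, ?_, rfl⟩
        rw [mem_closedBall_zero_iff] at hx
        rw [mem_ball_zero_iff] at hy ⊢
        refine lt_of_le_of_ne hx fun h1 => ?_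
        have : g x = x := by simp [hg, hfs x h1]
        rw [this, h1] at hy
        exact lt_irrefl _ hy
      · exact Or.inr hyc
  have key := lintegral_abs_det_fderiv_eq_addHaar_image volume
    (measurableSet_ball (x := (0 : E)) (ε := 1))
    (fun x _ => (hgd x).hasFDerivAt.hasFDerivWithinAt) (hinj.mono ball_subset_closedBall)
  rw [himage] at key
  rw [← key, integral_eq_lintegral_of_nonneg_ae]
  · congr 1
    refine setLIntegral_congr_fun measurableSet_ball fun x hx => ?_
    exact congrArg ENNReal.ofReal (abs_of_pos (hpos x (ball_subset_closedBall hx))).symm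
  · exact (ae_restrict_iff' measurableSet_ball).2
      (Filter.Eventually.of_forall fun x hx => (hpos x (ball_subset_closedBall hx)).le)
  · have h1 : Continuous (fderiv ℝ f) := hf.continuous_fderiv one_ne_zero
    exact (ContinuousLinearMap.continuous_det.comp (by fun_prop)).aestronglyMeasurable

/-- There is no `C¹` retraction onto the unit sphere. -/
theorem not_contDiff_retraction_sphere {f : E → E} (hf : ContDiff ℝ 1 f)
    (hf1 : ∀ x, ‖f x‖ = 1) : ¬ ∀ x, ‖x‖ = 1 → f x = x := by
  intro hfs
  have hdc : Continuous (fderiv ℝ f) := hf.continuous_fderiv one_ne_zero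
  obtain ⟨C₀, hC₀⟩ := (isCompact_closedBall (0 : E) 1).exists_bound_of_continuousOn
    (f := fun x => fderiv ℝ f x - ContinuousLinearMap.id ℝ E) (by fun_prop)
  set C : NNReal := C₀.toNNReal with hCdef
  have hC : ∀ x ∈ closedBall (0 : E) 1, ‖fderiv ℝ f x - ContinuousLinearMap.id ℝ E‖₊ ≤ C := by
    intro x hx
    rw [← NNReal.coe_le_coe, coe_nnnorm]
    exact (hC₀ x hx).trans (Real.le_coe_toNNReal _)
  -- More interpolation nodes than the degree, all so small that both `t < 1` and `t C < 1` hold at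
  -- each.
  obtain ⟨s, hsub, hcard⟩ := (Ioo_infinite
    (show (0 : ℝ) < 1 / (1 + C) by positivity)).exists_subset_card_eq (finrank ℝ E + 1)
  -- Differentiating `‖f‖² = 1` shows that the range of the derivative is orthogonal to `f x`; an
  -- invertible derivative would attain `f x` itself.
  have hdet0 : ∀ x, (fderiv ℝ f x).det = 0 := by
    intro x
    by_contra hne
    have hu : IsUnit (LinearMap.det ((fderiv ℝ f x : E →L[ℝ] E) : E →ₗ[ℝ] E)) :=
      isUnit_iff_ne_zero.2 hne
    obtain ⟨v, hv⟩ :=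
      ((Module.End.isUnit_iff _).1 ((LinearMap.isUnit_iff_isUnit_det _).2 hu)).2 (f x)
    have hd := (hf.differentiable one_ne_zero x).hasFDerivAt
    have h1 := hd.inner ℝ hd
    have h2 : (fun y => inner ℝ (f y) (f y)) = fun _ => (1 : ℝ) := by
      ext y
      rw [real_inner_self_eq_norm_sq, hf1, one_pow]
    rw [h2] at h1
    have h3 := congrArg (fun L : E →L[ℝ] ℝ => L v) (h1.unique (hasFDerivAt_const (1 : ℝ) x))
    have hv' : fderiv ℝ f x v = f x := hv
    simp [fderivInnerCLM_apply, hv', hf1] at h3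
  have hint : ∀ i : ℝ, IntegrableOn (fun x => (ContinuousLinearMap.id ℝ E +
      i • (fderiv ℝ f x - ContinuousLinearMap.id ℝ E)).det) (ball (0 : E) 1) := by
    intro i
    have : Continuous (fun x => (ContinuousLinearMap.id ℝ E +
      i • (fderiv ℝ f x - ContinuousLinearMap.id ℝ E)).det) :=
      ContinuousLinearMap.continuous_det.comp (by fun_prop)
    exact (this.continuousOn.integrableOn_compact (isCompact_closedBall 0 1)).mono_set
      ball_subset_closedBall
  -- The integrated determinant is a polynomial in `t`. It equals the volume of the ball at all
  -- nodes and vanishes at `t = 1`; as the Lagrange weights sum to one, the volume would be zero.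
  have hsum : (0 : ℝ) = ∑ i ∈ s, (volume (ball (0 : E) 1)).toReal *
      (Lagrange.basis s id i).eval 1 := by
    calc (0 : ℝ) = ∫ x in ball (0 : E) 1, (fderiv ℝ f x).det := by simp [hdet0]
      _ = ∫ x in ball (0 : E) 1, ∑ i ∈ s, (ContinuousLinearMap.id ℝ E +
          i • (fderiv ℝ f x - ContinuousLinearMap.id ℝ E)).det *
          (Lagrange.basis s id i).eval 1 := by
        congr 1
        ext x
        rw [← det_add_eq_sum_lagrange _ _ s (by omega)]
        congr 1
        abel
      _ = ∑ i ∈ s, (volume (ball (0 : E) 1)).toReal * (Lagrange.basis s id i).eval 1 := by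
        rw [integral_finsetSum _ fun i _ => (hint i).mul_const _]
        refine Finset.sum_congr rfl fun i hi => ?_
        rw [integral_mul_const]
        obtain ⟨hi0, hi1⟩ := hsub hi
        have hCp : (0 : ℝ) < 1 + C := by positivity
        rw [lt_div_iff₀ hCp] at hi1
        have hC0 : (0 : ℝ) ≤ C := C.2
        rw [integral_det_homotopy_eq_volume_ball hf hf1 hfs hC hi0.le (by nlinarith)
          (by nlinarith)]
  have hone := congrArg (Polynomial.eval 1)
    (Lagrange.sum_basis (s := s) (v := id) (injOn_id _) (Finset.card_pos.1 (by omega)))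
  rw [eval_finsetSum, eval_one] at hone
  rw [← Finset.mul_sum, hone, mul_one] at hsum
  exact (ENNReal.toReal_pos (measure_ball_pos _ _ one_pos).ne' measure_ball_lt_top.ne).ne hsum

/-- A map without zeros that points outwards can be deformed into the identity near the sphere
without creating zeros; its radial projection would then be a retraction. -/
theorem exists_zero_of_inner_pos {G : E → E} (hG : Continuous G) {R : ℝ} (hR : 0 < R)
    (hpos : ∀ x, R ≤ ‖x‖ → 0 < inner ℝ (G x) x) : ∃ x, G x = 0 := by
  by_contra! hne
  -- The factor `2 R` rescales the region of outward pointing to `1/2 ≤ ‖x‖`, leaving a shell inside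
  -- the unit ball for the blending.
  set H : E → E := fun x => G ((2 * R) • x) with hH
  have hHc : Continuous H := by fun_prop
  have hHpos : ∀ x, 1 / 2 ≤ ‖x‖ → 0 < inner ℝ (H x) x := by
    intro x hx
    have h1 := hpos ((2 * R) • x) (by
      rw [norm_smul, Real.norm_of_nonneg (by positivity)]
      nlinarith)
    rw [inner_smul_right] at h1
    exact pos_of_mul_pos_right h1 (by positivity)
  obtain ⟨ε₁, hε₁, hε₁'⟩ : ∃ ε > 0, ∀ x ∈ closedBall (0 : E) 1, ε ≤ ‖H x‖ := by
    obtain ⟨x, -, hx⟩ := (isCompact_closedBall (0 : E) 1).exists_isMinOn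
      ⟨0, by simp⟩ hHc.norm.continuousOn
    exact ⟨‖H x‖, norm_pos_iff.2 (hne _), fun y hy => hx hy⟩
  obtain ⟨ε₂, hε₂, hε₂'⟩ : ∃ ε > 0, ∀ x ∈ closedBall (0 : E) 1, 1 / 2 ≤ ‖x‖ →
      ε ≤ inner ℝ (H x) x := by
    have hK : IsCompact (closedBall (0 : E) 1 ∩ {x | 1 / 2 ≤ ‖x‖}) :=
      (isCompact_closedBall (0 : E) 1).inter_right (isClosed_le continuous_const continuous_norm)
    rcases (closedBall (0 : E) 1 ∩ {x | 1 / 2 ≤ ‖x‖}).eq_empty_or_nonempty with h0 | h0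
    · exact ⟨1, one_pos, fun x hx hx' => (h0.le ⟨hx, hx'⟩).elim⟩
    · obtain ⟨x, hx, hx'⟩ := hK.exists_isMinOn h0 (hHc.inner (𝕜 := ℝ) continuous_id).continuousOn
      exact ⟨inner ℝ (H x) x, hHpos x hx.2, fun y hy hy' => hx' ⟨hy, hy'⟩⟩
  -- By compactness nonvanishing and outward pointing hold with the margins `ε₁`, `ε₂`, so they
  -- survive a uniform smooth approximation.
  obtain ⟨g, hg, hgH⟩ : ∃ g : E → E, ContDiff ℝ (⊤ : ℕ∞) g ∧
      ∀ x ∈ closedBall (0 : E) 1, ‖H x - g x‖ < min ε₁ ε₂ := by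
    have h := ContinuousMap.dense_setOfPred_contDiff (E := E) (F := E) ⟨H, hHc⟩
    rw [mem_closure_iff_nhds_basis (nhds_basis_uniformity
      uniformity_basis_dist.compactConvergenceUniformity)] at h
    obtain ⟨g, hg, hgH⟩ := h (closedBall (0 : E) 1, min ε₁ ε₂)
      ⟨isCompact_closedBall 0 1, lt_min hε₁ hε₂⟩
    refine ⟨g, hg, fun x hx => ?_⟩
    have := hgH x hx
    simp only [ContinuousMap.coe_mk, mem_ofPred_eq, dist_eq_norm] at this
    rwa [norm_sub_rev]
  have hgne : ∀ x ∈ closedBall (0 : E) 1, g x ≠ 0 := by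
    intro x hx h0
    have h1 := hgH x hx
    rw [h0, sub_zero] at h1
    exact absurd (h1.trans_le (min_le_left _ _)) (not_lt.2 (hε₁' x hx))
  have hgpos : ∀ x ∈ closedBall (0 : E) 1, 1 / 2 ≤ ‖x‖ → 0 < inner ℝ (g x) x := by
    intro x hx hx'
    have h1 : inner ℝ (g x) x = inner ℝ (H x) x - inner ℝ (H x - g x) x := by
      rw [inner_sub_left]; ring
    have h2 := real_inner_le_norm (H x - g x) x
    have h3 := hε₂' x hx hx'
    have h4 := (hgH x hx).trans_le (min_le_right _ _)
    rw [mem_closedBall_zero_iff] at hx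
    have h5 : ‖H x - g x‖ * ‖x‖ ≤ ‖H x - g x‖ * 1 := by gcongr
    rw [h1]
    linarith
  -- Where the bump is strictly between zero and one, `1/2 ≤ ‖x‖` holds and both `g x` and `x` have
  -- positive inner product with `x`; hence the blend `φ` has no zero.
  let b : ContDiffBump (0 : E) := ⟨1 / 2, 1, by norm_num, by norm_num⟩
  set φ : E → E := fun x => b x • g x + (1 - b x) • x with hφ
  have hφd : ContDiff ℝ 1 φ := by
    have h1 : ContDiff ℝ 1 g := hg.of_le (by exact_mod_cast le_top)
    have h2 : ContDiff ℝ 1 b := b.contDiff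
    fun_prop
  have hφ1 : ∀ x, 1 ≤ ‖x‖ → φ x = x := by
    intro x hx
    have : b x = 0 := b.zero_of_le_dist (by simpa using hx)
    simp [hφ, this]
  have hφne : ∀ x, φ x ≠ 0 := by
    intro x h0
    rcases le_total 1 ‖x‖ with h1 | h1
    · rw [hφ1 x h1] at h0
      rw [h0, norm_zero] at h1
      linarith
    have hx : x ∈ closedBall (0 : E) 1 := by simpa using h1
    rcases le_total ‖x‖ (1 / 2) with h2 | h2
    · have : b x = 1 := b.one_of_mem_closedBall (by simpa [b] using h2)
      simp only [hφ, this, one_smul, sub_self, zero_smul, add_zero] at h0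
      exact hgne x hx h0
    · have h3 : inner ℝ (φ x) x = b x * inner ℝ (g x) x + (1 - b x) * ‖x‖ ^ 2 := by
        simp only [hφ, inner_add_left, real_inner_smul_left, real_inner_self_eq_norm_sq]
      rw [h0, inner_zero_left] at h3
      have h4 := hgpos x hx h2
      have h5 : 0 ≤ b x := b.nonneg
      have h6 : b x ≤ 1 := b.le_one
      have h7 : 0 < ‖x‖ ^ 2 := by positivity
      rcases h5.eq_or_lt with h8 | h8
      · rw [← h8] at h3
        linarith
      · have := mul_pos h8 h4
        have := mul_nonneg (sub_nonneg.2 h6) h7.le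
        linarith
  refine not_contDiff_retraction_sphere (f := fun x => ‖φ x‖⁻¹ • φ x) ?_ ?_ ?_
  · exact ((hφd.norm ℝ hφne).inv fun x => norm_ne_zero_iff.2 (hφne x)).smul hφd
  · intro x
    rw [norm_smul, norm_inv, norm_norm, inv_mul_cancel₀ (norm_ne_zero_iff.2 (hφne x))]
  · intro x hx
    simp [hφ1 x hx.ge, hx]

end NoRetraction

/-- A continuous nonlinear system on a finite-dimensional space is solvable if testing it with a
surjective linear image of the unknown is coercive. -/
theorem exists_zero_of_coercive {X : Type*} [AddCommGroup X] [Module ℝ X] [TopologicalSpace X]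
    [IsTopologicalAddGroup X] [ContinuousSMul ℝ X] [T2Space X] [FiniteDimensional ℝ X]
    (F : X → X →ₗ[ℝ] ℝ) (hF : ∀ z, Continuous fun y => F y z)
    (S : X →ₗ[ℝ] X) (hS : Function.Surjective S)
    (Q : X → ℝ) (hQc : Continuous Q) (hQ2 : ∀ (c : ℝ) y, Q (c • y) = c ^ 2 * Q y)
    (hQpos : ∀ y, y ≠ 0 → 0 < Q y) (b : ℝ) (hFQ : ∀ y, Q y - b ≤ F y (S y)) :
    ∃ y, F y = 0 := by
  let e : X ≃L[ℝ] EuclideanSpace ℝ (Fin (Module.finrank ℝ X)) := toEuclidean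
  -- The Riesz representative of `z ↦ F x (S z)`, so that its inner product with `x` is the tested
  -- quantity. Since `S` is onto, a zero of `G` annihilates the whole functional.
  let G : EuclideanSpace ℝ (Fin (Module.finrank ℝ X)) →
      EuclideanSpace ℝ (Fin (Module.finrank ℝ X)) := fun x =>
    ∑ i, F (e.symm x) (S (e.symm (EuclideanSpace.single i 1))) • EuclideanSpace.single i (1 : ℝ)
  have hGc : Continuous G := by
    refine continuous_finsetSum _ fun i _ => ?_
    exact ((hF _).comp e.symm.continuous).smul continuous_const
  have hGi : ∀ x z, inner ℝ (G x) z = F (e.symm x) (S (e.symm z)) := by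
    intro x z
    have hz : z = ∑ i, z i • EuclideanSpace.single i (1 : ℝ) := by
      ext j
      simp [Finset.sum_apply, Pi.single_apply]
    conv_rhs => rw [hz]
    simp only [G, sum_inner, real_inner_smul_left, EuclideanSpace.inner_single_left, map_sum,
      map_smul, smul_eq_mul]
    refine Finset.sum_congr rfl fun i _ => ?_
    simp [mul_comm]
  obtain ⟨c, hc, hcQ⟩ : ∃ c > 0, ∀ x, c * ‖x‖ ^ 2 ≤ Q (e.symm x) := by
    rcases (Metric.sphere (0 : EuclideanSpace ℝ (Fin (Module.finrank ℝ X))) 1).eq_empty_or_nonempty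
      with h0 | h0
    · refine ⟨1, one_pos, fun x => ?_⟩
      have hx : x = 0 := by
        by_contra hx
        have : ‖x‖⁻¹ • x ∈ Metric.sphere (0 : EuclideanSpace ℝ (Fin (Module.finrank ℝ X))) 1 := by
          simp [norm_smul, norm_ne_zero_iff.2 hx]
        rw [h0] at this
        exact this
      have := hQ2 0 0
      simp [hx] at this ⊢
      simp [this]
    · obtain ⟨x, hx, hx'⟩ := (isCompact_sphere (0 : EuclideanSpace ℝ (Fin (Module.finrank ℝ X)))
        1).exists_isMinOn h0 (hQc.comp e.symm.continuous).continuousOn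
      refine ⟨Q (e.symm x), hQpos _ ?_, fun y => ?_⟩
      · intro h
        rw [ContinuousLinearEquiv.map_eq_zero_iff] at h
        simp [h] at hx
      · by_cases hy : y = 0
        · have := hQ2 0 0
          simp at this
          simp [hy, this]
        · have h1 : Q (e.symm x) ≤ Q (e.symm (‖y‖⁻¹ • y)) := by
            refine hx' ?_
            simp [norm_smul, norm_ne_zero_iff.2 hy]
          rw [map_smul, hQ2] at h1
          have h2 : 0 < ‖y‖ := norm_pos_iff.2 hy
          calc Q (e.symm x) * ‖y‖ ^ 2 ≤ (‖y‖⁻¹ ^ 2 * Q (e.symm y)) * ‖y‖ ^ 2 := by gcongr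
            _ = Q (e.symm y) := by field_simp
  -- The radius `R` is at least one, so `‖x‖ ≥ R` gives `c ‖x‖² ≥ c R = c + |b| > b`.
  obtain ⟨x, hx⟩ := exists_zero_of_inner_pos hGc (R := 1 + |b| / c) (by positivity) (by
    intro x hx
    rw [hGi]
    have h1 := hFQ (e.symm x)
    have h2 := hcQ x
    have h3 : 1 + |b| / c ≤ ‖x‖ ^ 2 := by
      have : 0 ≤ |b| / c := by positivity
      nlinarith
    have h4 : c * (1 + |b| / c) = c + |b| := by field_simp
    have h5 := mul_le_mul_of_nonneg_left h3 hc.le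
    linarith [le_abs_self b])
  refine ⟨e.symm x, ?_⟩
  ext z
  obtain ⟨w, rfl⟩ := hS z
  have := hGi x (e w)
  rw [hx, inner_zero_left, e.symm_apply_apply] at this
  rw [← this, LinearMap.zero_apply]

noncomputable section

namespace CHAC

/-! ### The finite element space: differentiability inside cells and finite dimension. -/

namespace Grid

open Topology BoundedContinuousFunction

variable {d : ℕ} {G : Grid d} {h : ℝ}

theorem isCompact_Om (hG : G.IsMesh h) : IsCompact G.Om := by
  rw [← hG.cover]
  exact G.cells.isCompact_biUnion fun K _ => K.finite_toSet.isCompact_convexHull ℝ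

theorem convex_Om : Convex ℝ G.Om := by
  intro x hx y hy a b ha hb hab i
  have hi := convex_Icc (G.corner i) (G.corner i + G.side) (hx i) (hy i) ha hb hab
  simpa using hi

theorem simplex_subset_Om (hG : G.IsMesh h) {K : Finset (E d)} (hK : K ∈ G.cells) :
    simplex K ⊆ G.Om := by
  rw [← hG.cover]
  exact subset_biUnion_of_mem (u := fun K : Finset (E d) => simplex K) hK

/-- The union of the interiors of the simplices. -/
def cellInteriors (G : Grid d) : Set (E d) := ⋃ K ∈ G.cells, interior (simplex K)

theorem isOpen_cellInteriors : IsOpen G.cellInteriors :=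
  isOpen_biUnion fun _ _ => isOpen_interior

/-- The frontiers of the finitely many convex cells are null sets. Gradient identities therefore
need to be checked only where finite element functions are differentiable. -/
theorem ae_mem_cellInteriors (hG : G.IsMesh h) :
    ∀ᵐ x ∂(volume.restrict G.Om), x ∈ G.cellInteriors := by
  rw [ae_restrict_iff' (isCompact_Om hG).measurableSet]
  have hnull : ∀ᵐ x ∂(volume : Measure (E d)), ∀ K ∈ G.cells, x ∉ frontier (simplex K) := by
    rw [Filter.eventually_all_finset]
    intro K _
    exact measure_eq_zero_iff_ae_notMem.1 ((convex_convexHull ℝ _).addHaar_frontier volume)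
  filter_upwards [hnull] with x hx hxO
  rw [← hG.cover] at hxO
  obtain ⟨K, hK, hxK⟩ := mem_iUnion₂.1 hxO
  refine mem_iUnion₂.2 ⟨K, hK, ?_⟩
  by_contra hint
  exact hx K hK ⟨subset_closure hxK, hint⟩

theorem contDiff_mvPolynomial_eval (p : MvPolynomial (Fin d) ℝ) :
    ContDiff ℝ 1 fun x : E d => MvPolynomial.eval (fun i => x i) p := by
  induction p using MvPolynomial.induction_on with
  | C a => simpa using contDiff_const
  | add p q hp hq => simpa using hp.add hq
  | mul_X p i hp =>
    simp only [map_mul, MvPolynomial.eval_X]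
    exact hp.mul (by fun_prop)

theorem exists_contDiff_eqOn_simplex (v : G.Vh) {K : Finset (E d)} (hK : K ∈ G.cells) :
    ∃ g : E d → ℝ, ContDiff ℝ 1 g ∧ EqOn v.1 g (simplex K) := by
  obtain ⟨p, -, hp⟩ := v.2.2.2 K hK
  exact ⟨_, contDiff_mvPolynomial_eval p, hp⟩

theorem contDiffAt_of_mem_cellInteriors (v : G.Vh) {x : E d} (hx : x ∈ G.cellInteriors) :
    ContDiffAt ℝ 1 v.1 x := by
  obtain ⟨K, hK, hxK⟩ := mem_iUnion₂.1 hx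
  obtain ⟨g, hg, hvg⟩ := exists_contDiff_eqOn_simplex v hK
  exact hg.contDiffAt.congr_of_eventuallyEq
    (hvg.eventuallyEq_of_mem (mem_interior_iff_mem_nhds.1 hxK))

theorem differentiableAt_of_mem_cellInteriors (v : G.Vh) {x : E d} (hx : x ∈ G.cellInteriors) :
    DifferentiableAt ℝ v.1 x :=
  (contDiffAt_of_mem_cellInteriors v hx).differentiableAt one_ne_zero

theorem gradient_add_of_mem (u v : G.Vh) {x : E d} (hx : x ∈ G.cellInteriors) :
    gradient (u + v).1 x = gradient u.1 x + gradient v.1 x := by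
  have := fderiv_add (differentiableAt_of_mem_cellInteriors u hx)
    (differentiableAt_of_mem_cellInteriors v hx)
  have h2 : ((u + v).1 : E d → ℝ) = u.1 + v.1 := rfl
  simp only [gradient, h2, this, map_add]

theorem gradient_smul_of_mem (c : ℝ) (v : G.Vh) {x : E d} (hx : x ∈ G.cellInteriors) :
    gradient (c • v).1 x = c • gradient v.1 x := by
  have := fderiv_const_smul (differentiableAt_of_mem_cellInteriors v hx) c
  have h2 : ((c • v).1 : E d → ℝ) = c • v.1 := rfl
  simp only [gradient, h2, this, map_smul]

theorem continuousOn_gradient (v : G.Vh) :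
    ContinuousOn (gradient v.1) G.cellInteriors := by
  intro x hx
  have h1 : ContinuousAt (fderiv ℝ v.1) x :=
    (contDiffAt_of_mem_cellInteriors v hx).continuousAt_fderiv one_ne_zero
  exact ((LinearIsometryEquiv.continuous _).continuousAt.comp h1).continuousWithinAt

theorem exists_bound_gradient (v : G.Vh) :
    ∃ C, ∀ x ∈ G.cellInteriors, ‖gradient v.1 x‖ ≤ C := by
  have hK : ∀ K ∈ G.cells, ∃ C, ∀ x ∈ interior (simplex K), ‖gradient v.1 x‖ ≤ C := by
    intro K hK
    obtain ⟨g, hg, hvg⟩ := exists_contDiff_eqOn_simplex v hK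
    have hcpt : IsCompact (simplex K) := K.finite_toSet.isCompact_convexHull ℝ
    obtain ⟨C, hC⟩ := hcpt.exists_bound_of_continuousOn
      (hg.continuous_fderiv one_ne_zero).continuousOn
    refine ⟨C, fun x hx => ?_⟩
    have h1 := (hvg.eventuallyEq_of_mem (mem_interior_iff_mem_nhds.1 hx)).fderiv_eq (𝕜 := ℝ)
    rw [gradient, LinearIsometryEquiv.norm_map, h1]
    exact hC x (interior_subset hx)
  choose! C hC using hK
  refine ⟨∑ K ∈ G.cells, |C K|, fun x hx => ?_⟩
  obtain ⟨K, hK, hxK⟩ := mem_iUnion₂.1 hx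
  exact (hC K hK x hxK).trans ((le_abs_self _).trans
    (Finset.single_le_sum (f := fun K => |C K|) (fun _ _ => abs_nonneg _) hK))

theorem eq_zero_of_eqOn_Om (hside : 0 < G.side) (v : G.Vh) (hv : ∀ x ∈ G.Om, v.1 x = 0) :
    v = 0 := by
  ext x
  -- The integer shift that moves each coordinate of `x` into the period cell.
  let z : Fin d → ℤ := fun i => -⌊(x i - G.corner i) / G.side⌋
  rw [← v.2.2.1 x z]
  refine hv _ fun i => ?_
  have h1 := Int.floor_le ((x i - G.corner i) / G.side)
  have h2 := Int.lt_floor_add_one ((x i - G.corner i) / G.side)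
  rw [le_div_iff₀ hside] at h1
  rw [div_lt_iff₀ hside] at h2
  simp only [period, PiLp.add_apply, z, Int.cast_neg, mem_Icc]
  constructor <;> nlinarith

/-- Restriction to the cells is injective by covering and periodicity, and takes values in the image
of a finite product of spaces of quadratic polynomials. -/
theorem finiteDimensional_Vh (hG : G.IsMesh h) (hside : 0 < G.side) :
    FiniteDimensional ℝ G.Vh := by
  let restr : G.Vh →ₗ[ℝ] ((K : G.cells) → simplex K.1 → ℝ) :=
    { toFun := fun v K x => v.1 x
      map_add' := fun _ _ => rfl
      map_smul' := fun _ _ => rfl }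
  let polys : ((K : G.cells) → MvPolynomial.restrictTotalDegree (Fin d) ℝ 2) →ₗ[ℝ]
      ((K : G.cells) → simplex K.1 → ℝ) :=
    { toFun := fun p K x => MvPolynomial.eval (fun i => x.1 i) (p K).1
      map_add' := fun p q => by ext; simp
      map_smul' := fun c p => by ext; simp [MvPolynomial.smul_eval] }
  have hrange : ∀ v, restr v ∈ LinearMap.range polys := by
    intro v
    choose p hp hp' using v.2.2.2
    refine ⟨fun K => ⟨p K.1 K.2, (MvPolynomial.mem_restrictTotalDegree _ _ _).2 (hp _ _)⟩, ?_⟩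
    ext K x
    exact (hp' K.1 K.2 x.1 x.2).symm
  have hinj : Function.Injective (restr.codRestrict (LinearMap.range polys) hrange) := by
    rw [← LinearMap.ker_eq_bot, LinearMap.ker_codRestrict, LinearMap.ker_eq_bot']
    intro v hv
    have hOm : ∀ x ∈ G.Om, v.1 x = 0 := by
      intro x hx
      rw [← hG.cover] at hx
      obtain ⟨K, hK, hxK⟩ := mem_iUnion₂.1 hx
      exact congrFun (congrFun hv ⟨K, hK⟩) ⟨x, hxK⟩
    exact eq_zero_of_eqOn_Om hside v hOm
  exact Module.Finite.of_injective _ hinj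

/-- A finite element function together with its gradient. -/
def jet (v : G.Vh) (x : E d) : ℝ × E d := (v.1 x, gradient v.1 x)

theorem jet_add_of_mem (u v : G.Vh) {x : E d} (hx : x ∈ G.cellInteriors) :
    jet (u + v) x = jet u x + jet v x :=
  Prod.ext rfl (gradient_add_of_mem u v hx)

theorem jet_smul_of_mem (c : ℝ) (v : G.Vh) {x : E d} (hx : x ∈ G.cellInteriors) :
    jet (c • v) x = c • jet v x :=
  Prod.ext rfl (gradient_smul_of_mem c v hx)

theorem jet_sub_of_mem (u v : G.Vh) {x : E d} (hx : x ∈ G.cellInteriors) :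
    jet (u - v) x = jet u x - jet v x := by
  rw [sub_eq_add_neg, ← neg_one_smul ℝ v, jet_add_of_mem _ _ hx, jet_smul_of_mem _ _ hx]
  module

theorem exists_bound_jet (hG : G.IsMesh h) (v : G.Vh) :
    ∃ C, ∀ x ∈ G.cellInteriors, ‖jet v x‖ ≤ C := by
  obtain ⟨C, hC⟩ := exists_bound_gradient v
  obtain ⟨C', hC'⟩ := (isCompact_Om hG).exists_bound_of_continuousOn v.2.1.continuousOn
  refine ⟨max C' C, fun x hx => ?_⟩
  obtain ⟨K, hK, hxK⟩ := mem_iUnion₂.1 hx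
  exact max_le_max (hC' x (simplex_subset_Om hG hK (interior_subset hxK))) (hC x hx)

theorem continuousOn_jet (v : G.Vh) : ContinuousOn (jet v) G.cellInteriors :=
  v.2.1.continuousOn.prodMk (continuousOn_gradient v)

/-- The jet as a linear map into bounded continuous functions. -/
def jetL (hG : G.IsMesh h) : G.Vh →ₗ[ℝ] (G.cellInteriors →ᵇ ℝ × E d) where
  toFun v := BoundedContinuousFunction.ofNormedAddCommGroup (fun x => jet v x.1)
    (continuousOn_iff_continuous_domRestrict.1 (continuousOn_jet v)) (exists_bound_jet hG v).choose
    fun x => (exists_bound_jet hG v).choose_spec x.1 x.2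
  map_add' u v := by
    ext1 x
    exact jet_add_of_mem u v x.2
  map_smul' c v := by
    ext1 x
    exact jet_smul_of_mem c v x.2

/-! ### Integrals of continuous functions of jets. -/

section Integrals

variable {ι : Type*} {Φ : (ι → ℝ × E d) → ℝ}

theorem aestronglyMeasurable_comp_jet (hG : G.IsMesh h) (hΦ : Continuous Φ) (W : ι → G.Vh) :
    AEStronglyMeasurable (fun x => Φ fun i => jet (W i) x) (volume.restrict G.Om) := by
  have h1 : ContinuousOn (fun x => Φ fun i => jet (W i) x) G.cellInteriors :=
    hΦ.comp_continuousOn (continuousOn_pi.2 fun i => continuousOn_jet (W i))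
  have h2 := h1.aestronglyMeasurable (μ := volume.restrict G.Om) isOpen_cellInteriors.measurableSet
  rwa [Measure.restrict_eq_self_of_ae_mem (ae_mem_cellInteriors hG)] at h2

theorem exists_bound_comp_jet (hΦ : Continuous Φ) (R : ℝ) :
    ∃ C, ∀ (W : ι → G.Vh) (x : E d), (∀ i, ‖jet (W i) x‖ ≤ R) →
      ‖Φ fun i => jet (W i) x‖ ≤ C := by
  obtain ⟨C, hC⟩ := (isCompact_univ_pi fun _ : ι =>
    isCompact_closedBall (0 : ℝ × E d) R).exists_bound_of_continuousOn hΦ.continuousOn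
  exact ⟨C, fun W x hW => hC _ fun i _ => by simpa using hW i⟩

variable [Fintype ι]

theorem integrableOn_comp_jet (hG : G.IsMesh h) (hΦ : Continuous Φ) (W : ι → G.Vh) :
    IntegrableOn (fun x => Φ fun i => jet (W i) x) G.Om := by
  choose C hC using exists_bound_jet (G := G) hG
  obtain ⟨C', hC'⟩ := exists_bound_comp_jet (G := G) hΦ (∑ i, |C (W i)|)
  have : IsFiniteMeasure (volume.restrict G.Om) :=
    ⟨by simpa using (isCompact_Om hG).measure_lt_top⟩
  refine Integrable.of_bound (aestronglyMeasurable_comp_jet hG hΦ W) C' ?_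
  filter_upwards [ae_mem_cellInteriors hG] with x hx
  refine hC' W x fun i => (hC _ x hx).trans ((le_abs_self _).trans
    (Finset.single_le_sum (f := fun i => |C (W i)|) (fun _ _ => abs_nonneg _)
      (Finset.mem_univ i)))

/-- `jetL` is linear on a finite-dimensional space, hence continuous in the supremum norm. Near `W₀`
the integrands are thus uniformly bounded and depend continuously on `W` at almost every point;
dominated convergence applies. -/
theorem continuous_integral_comp_jet (hG : G.IsMesh h) (hside : 0 < G.side) (hΦ : Continuous Φ) :
    Continuous fun W : ι → G.Vh => ∫ x in G.Om, Φ fun i => jet (W i) x := by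
  have := finiteDimensional_Vh hG hside
  have : FirstCountableTopology G.Vh :=
    (toEuclidean (E := G.Vh)).toHomeomorph.isInducing.firstCountableTopology
  have hfin : IsFiniteMeasure (volume.restrict G.Om) :=
    ⟨by simpa using (isCompact_Om hG).measure_lt_top⟩
  have hJ : Continuous (jetL hG) := LinearMap.continuous_of_finiteDimensional _
  rw [continuous_iff_continuousAt]
  intro W₀
  let R := ∑ i, (‖jetL hG (W₀ i)‖ + 1)
  obtain ⟨C, hC⟩ := exists_bound_comp_jet (G := G) hΦ R
  refine continuousAt_of_dominated (bound := fun _ => C)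
    (Filter.Eventually.of_forall fun W => aestronglyMeasurable_comp_jet hG hΦ W) ?_
    (integrable_const C) ?_
  · have hnear : ∀ᶠ W : ι → G.Vh in 𝓝 W₀, ∀ i, ‖jetL hG (W i)‖ < ‖jetL hG (W₀ i)‖ + 1 := by
      rw [Filter.eventually_all]
      intro i
      have h1 : Continuous fun W : ι → G.Vh => ‖jetL hG (W i)‖ :=
        (hJ.comp (continuous_apply i)).norm
      exact h1.continuousAt.eventually_lt_const (lt_add_one _)
    filter_upwards [hnear] with W hW
    filter_upwards [ae_mem_cellInteriors hG] with x hx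
    refine hC W x fun i => ?_
    have h1 : ‖jet (W i) x‖ ≤ ‖jetL hG (W i)‖ := (jetL hG (W i)).norm_coe_le_norm ⟨x, hx⟩
    exact (h1.trans (hW i).le).trans (Finset.single_le_sum
      (f := fun i => ‖jetL hG (W₀ i)‖ + 1) (fun _ _ => by positivity) (Finset.mem_univ i))
  · filter_upwards [ae_mem_cellInteriors hG] with x hx
    have h1 : ∀ i, Continuous fun W : ι → G.Vh => jet (W i) x := fun i =>
      (BoundedContinuousFunction.lipschitz_eval_const (⟨x, hx⟩ : G.cellInteriors)).continuous.comp
        (hJ.comp (continuous_apply i))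
    exact (hΦ.comp (continuous_pi h1)).continuousAt

end Integrals

/-- A finite element function whose gradient vanishes almost everywhere is constant on `Ω`. -/
theorem eq_of_gradient_eq_zero (hG : G.IsMesh h) (v : G.Vh)
    (hv : ∀ᵐ x ∂(volume.restrict G.Om), gradient v.1 x = 0) {x y : E d}
    (hx : x ∈ G.Om) (hy : y ∈ G.Om) : v.1 x = v.1 y := by
  have hU : G.cellInteriors ⊆ G.Om := iUnion₂_subset fun K hK =>
    interior_subset.trans (simplex_subset_Om hG hK)
  have hzero : ∀ z ∈ G.cellInteriors, gradient v.1 z = 0 := by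
    have h1 : ∀ᵐ x ∂(volume.restrict G.cellInteriors), gradient v.1 x = (fun _ => 0) x :=
      ae_restrict_of_ae_restrict_of_subset hU hv
    exact Measure.eqOn_open_of_ae_eq h1 isOpen_cellInteriors (continuousOn_gradient v)
      continuousOn_const
  have hcell : ∀ K ∈ G.cells, ∃ c, ∀ z ∈ simplex K, v.1 z = c := by
    intro K hK
    have hconv : Convex ℝ (simplex K) := convex_convexHull ℝ _
    have hne : (interior (simplex K)).Nonempty := by
      rw [simplex, interior_convexHull_nonempty_iff_affineSpan_eq_top]
      have h1 := (hG.nondegenerate K hK).affineSpan_eq_top_iff_card_eq_finrank_add_one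
      rw [Subtype.range_coe_subtype] at h1
      refine (h1.2 ?_)
      simp [hG.card_vertices K hK]
    obtain ⟨z₀, hz₀⟩ := hne
    have hconst : ∀ z ∈ interior (simplex K), v.1 z = v.1 z₀ := by
      intro z hz
      refine hconv.interior.is_const_of_fderivWithin_eq_zero (𝕜 := ℝ) ?_ ?_ hz hz₀
      · intro w hw
        exact (differentiableAt_of_mem_cellInteriors v
          (mem_iUnion₂.2 ⟨K, hK, hw⟩)).differentiableWithinAt
      · intro w hw
        rw [fderivWithin_of_isOpen isOpen_interior hw, ← toDual_gradient,
          hzero w (mem_iUnion₂.2 ⟨K, hK, hw⟩), map_zero]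
    refine ⟨v.1 z₀, fun z hz => ?_⟩
    have h2 : z ∈ closure (interior (simplex K)) := by
      rw [hconv.closure_interior_eq_closure_of_nonempty_interior ⟨z₀, hz₀⟩]
      exact subset_closure hz
    exact (isClosed_eq v.2.1 continuous_const).closure_subset_iff.2 hconst h2
  choose! c hc using hcell
  -- There are finitely many values, one for each cell, while the image of the convex set `Ω` is
  -- connected; so no chain of neighbouring cells has to be followed.
  have hfin : (v.1 '' G.Om).Finite := by
    refine (G.cells.finite_toSet.image c).subset ?_
    rintro _ ⟨z, hz, rfl⟩
    rw [← hG.cover] at hz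
    obtain ⟨K, hK, hzK⟩ := mem_iUnion₂.1 hz
    exact ⟨K, hK, (hc K hK z hzK).symm⟩
  have hpre : IsPreconnected (v.1 '' G.Om) :=
    convex_Om.isPreconnected.image _ v.2.1.continuousOn
  by_contra hne
  exact hpre.infinite_of_nontrivial ⟨_, mem_image_of_mem _ hx, _, mem_image_of_mem _ hy, hne⟩ hfin

end Grid

/-! ### Mobility matrix and segment averages of the potential. -/

namespace Model

variable {d : ℕ} {M : Model d}

theorem GoodMobility.continuous_L (hM : M.GoodMobility) (i j : Fin d ⊕ Unit) :
    Continuous fun w => M.L w i j :=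
  (hM.contDiff i j).continuous

theorem GoodMobility.continuous_L11 (hM : M.GoodMobility) :
    Continuous fun p : State d × E d => M.L11 p.1 p.2 := by
  refine (PiLp.continuous_toLp 2 _).comp (continuous_pi fun i => ?_)
  change Continuous fun p : State d × E d => ∑ j, M.L p.1 (Sum.inl i) (Sum.inl j) * p.2 j
  refine continuous_finsetSum _ fun j _ => ?_
  exact ((hM.continuous_L _ _).comp continuous_fst).mul (by fun_prop)

theorem GoodMobility.continuous_L12 (hM : M.GoodMobility) : Continuous M.L12 :=
  (PiLp.continuous_toLp 2 _).comp (continuous_pi fun _ => hM.continuous_L _ _)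

theorem GoodMobility.continuous_L22 (hM : M.GoodMobility) : Continuous M.L22 :=
  hM.continuous_L _ _

/-- The vector `(∇μ_ρ, μ_η)` assembled from its blocks. -/
def forceVec (y : E d) (c : ℝ) : Fin d ⊕ Unit → ℝ := Sum.elim (fun i => y i) fun _ => c

theorem forceVec_dotProduct_self (y : E d) (c : ℝ) :
    forceVec y c ⬝ᵥ forceVec y c = ‖y‖ ^ 2 + c ^ 2 := by
  simp [forceVec, dotProduct, EuclideanSpace.real_norm_sq_eq, ← sq]

/-- The block form of the bilinear form of the mobility matrix. -/
theorem inner_blocks_eq (hM : M.GoodMobility) (w : State d) (y z : E d) (c e : ℝ) :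
    inner ℝ (M.L11 w y + c • M.L12 w) z + (inner ℝ (M.L12 w) y + M.L22 w * c) * e
      = forceVec z e ⬝ᵥ (M.L w *ᵥ forceVec y c) := by
  have hs : ∀ i, M.L w (Sum.inr ()) i = M.L w i (Sum.inr ()) := fun i => (hM.symm w).apply _ _
  simp only [forceVec, dotProduct, Matrix.mulVec, Fintype.sum_sum_type, Sum.elim_inl,
    Sum.elim_inr, PiLp.inner_apply, L11, L12, L22, Matrix.toBlocks₁₁, PiLp.add_apply,
    PiLp.smul_apply, Matrix.of_apply, RCLike.inner_apply, conj_trivial, smul_eq_mul,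
    Finset.univ_unique, Finset.sum_singleton, PUnit.default_eq_unit, hs]
  congr 1
  · refine Finset.sum_congr rfl fun i _ => ?_
    ring
  · rw [mul_comm]
    congr 2
    refine Finset.sum_congr rfl fun i _ => ?_
    ring

/-- A Cauchy-Schwarz inequality for the last row of the mobility matrix. -/
theorem GoodMobility.sq_last_row_le (hM : M.GoodMobility) {lam1 lam2 : ℝ} (h1 : 0 < lam1)
    (hb : ∀ (w : State d) (xi : Fin d ⊕ Unit → ℝ),
      lam1 * (xi ⬝ᵥ xi) ≤ xi ⬝ᵥ (M.L w *ᵥ xi) ∧ xi ⬝ᵥ (M.L w *ᵥ xi) ≤ lam2 * (xi ⬝ᵥ xi))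
    (w : State d) (y : E d) (c : ℝ) :
    (inner ℝ (M.L12 w) y + M.L22 w * c) ^ 2
      ≤ lam2 * (forceVec y c ⬝ᵥ (M.L w *ᵥ forceVec y c)) := by
  have hexp : ∀ s : ℝ, forceVec y (c + s) ⬝ᵥ (M.L w *ᵥ forceVec y (c + s))
      = forceVec y c ⬝ᵥ (M.L w *ᵥ forceVec y c)
        + 2 * s * (inner ℝ (M.L12 w) y + M.L22 w * c) + s ^ 2 * M.L22 w := by
    intro s
    rw [← inner_blocks_eq hM, ← inner_blocks_eq hM]
    simp only [inner_add_left, real_inner_smul_left]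
    ring
  have h22 : M.L22 w ≤ lam2 := by
    have := (hb w (forceVec 0 1)).2
    rw [← inner_blocks_eq hM, forceVec_dotProduct_self] at this
    simpa using this
  have h22' : 0 < M.L22 w := by
    have := (hb w (forceVec 0 1)).1
    rw [← inner_blocks_eq hM, forceVec_dotProduct_self] at this
    simp at this
    linarith
  have hnonneg : ∀ z a, 0 ≤ forceVec z a ⬝ᵥ (M.L w *ᵥ forceVec z a) := by
    intro z a
    refine le_trans ?_ (hb w (forceVec z a)).1
    rw [forceVec_dotProduct_self]
    positivity
  set q := forceVec y c ⬝ᵥ (M.L w *ᵥ forceVec y c) with hq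
  set b := inner ℝ (M.L12 w) y + M.L22 w * c with hbdef
  -- The shift of the last component that minimizes the quadratic form; nonnegativity of the minimum
  -- is the Cauchy-Schwarz inequality `b² ≤ L₂₂ q`.
  have h3 := hnonneg y (c + -(b / M.L22 w))
  rw [hexp] at h3
  have h4 : q + 2 * -(b / M.L22 w) * b + (-(b / M.L22 w)) ^ 2 * M.L22 w
      = q - b ^ 2 / M.L22 w := by field_simp; ring
  rw [h4, sub_nonneg, div_le_iff₀ h22'] at h3
  have := mul_le_mul_of_nonneg_left h22 (hnonneg y c)
  linarith

theorem GoodPotential.hasFDerivAt (hf : M.GoodPotential) (p : ℝ × ℝ) :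
    HasFDerivAt (fun p : ℝ × ℝ => M.f p.1 p.2) (fderiv ℝ (fun p : ℝ × ℝ => M.f p.1 p.2) p) p :=
  (hf.contDiff.differentiable (by norm_num) p).hasFDerivAt

theorem GoodPotential.fRho_eq (hf : M.GoodPotential) (r e : ℝ) :
    M.fRho r e = fderiv ℝ (fun p : ℝ × ℝ => M.f p.1 p.2) (r, e) (1, 0) := by
  have h1 : HasDerivAt (fun r' : ℝ => (r', e)) ((1 : ℝ), (0 : ℝ)) r :=
    (hasDerivAt_id r).prodMk (hasDerivAt_const r e)
  exact ((hf.hasFDerivAt (r, e)).comp_hasDerivAt r h1).deriv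

theorem GoodPotential.fEta_eq (hf : M.GoodPotential) (r e : ℝ) :
    M.fEta r e = fderiv ℝ (fun p : ℝ × ℝ => M.f p.1 p.2) (r, e) (0, 1) := by
  have h1 : HasDerivAt (fun e' : ℝ => (r, e')) ((0 : ℝ), (1 : ℝ)) e :=
    (hasDerivAt_const e r).prodMk (hasDerivAt_id e)
  exact ((hf.hasFDerivAt (r, e)).comp_hasDerivAt e h1).deriv

theorem GoodPotential.continuous_fRho (hf : M.GoodPotential) :
    Continuous fun p : ℝ × ℝ => M.fRho p.1 p.2 := by
  simp only [hf.fRho_eq]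
  exact (hf.contDiff.continuous_fderiv (by norm_num)).clm_apply continuous_const

theorem GoodPotential.continuous_fEta (hf : M.GoodPotential) :
    Continuous fun p : ℝ × ℝ => M.fEta p.1 p.2 := by
  simp only [hf.fEta_eq]
  exact (hf.contDiff.continuous_fderiv (by norm_num)).clm_apply continuous_const

/-- The average of a function of two variables along the segment from `(r₀, e₀)` to `(r₁, e₁)`. -/
def segAvg (g : ℝ → ℝ → ℝ) (r₀ r₁ e₀ e₁ : ℝ) : ℝ :=
  ∫ θ in (0 : ℝ)..1, g (r₀ + θ * (r₁ - r₀)) (e₀ + θ * (e₁ - e₀))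

theorem continuous_segAvg {g : ℝ → ℝ → ℝ} (hg : Continuous fun p : ℝ × ℝ => g p.1 p.2)
    {Y : Type*} [TopologicalSpace Y] {r₀ r₁ e₀ e₁ : Y → ℝ}
    (hr₀ : Continuous r₀) (hr₁ : Continuous r₁) (he₀ : Continuous e₀) (he₁ : Continuous e₁) :
    Continuous fun y => segAvg g (r₀ y) (r₁ y) (e₀ y) (e₁ y) := by
  have h1 : Continuous fun p : ℝ × ℝ × ℝ × ℝ => segAvg g p.1 p.2.1 p.2.2.1 p.2.2.2 := by
    refine intervalIntegral.continuous_parametric_intervalIntegral_of_continuous' ?_ 0 1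
    exact hg.comp (f := fun q : (ℝ × ℝ × ℝ × ℝ) × ℝ =>
      (q.1.1 + q.2 * (q.1.2.1 - q.1.1), q.1.2.2.1 + q.2 * (q.1.2.2.2 - q.1.2.2.1))) (by fun_prop)
  exact h1.comp (hr₀.prodMk (hr₁.prodMk (he₀.prodMk he₁)))

/-- The chain rule integrated along the segment. It is exact, which is why the energy law holds
without a quadrature error. -/
theorem GoodPotential.sub_eq_segAvg (hf : M.GoodPotential) (r₀ r₁ e₀ e₁ : ℝ) :
    M.f r₁ e₁ - M.f r₀ e₀ = segAvg M.fRho r₀ r₁ e₀ e₁ * (r₁ - r₀)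
      + segAvg M.fEta r₀ r₁ e₀ e₁ * (e₁ - e₀) := by
  have hd : ∀ θ ∈ uIcc (0 : ℝ) 1, HasDerivAt
      (fun θ : ℝ => M.f (r₀ + θ * (r₁ - r₀)) (e₀ + θ * (e₁ - e₀)))
      (M.fRho (r₀ + θ * (r₁ - r₀)) (e₀ + θ * (e₁ - e₀)) * (r₁ - r₀)
        + M.fEta (r₀ + θ * (r₁ - r₀)) (e₀ + θ * (e₁ - e₀)) * (e₁ - e₀)) θ := by
    intro θ _
    have hline : ∀ a b : ℝ, HasDerivAt (fun θ : ℝ => a + θ * (b - a)) (b - a) θ := by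
      intro a b
      simpa using ((hasDerivAt_id θ).mul_const (b - a)).const_add a
    have h1 := (hf.hasFDerivAt (r₀ + θ * (r₁ - r₀), e₀ + θ * (e₁ - e₀))).comp_hasDerivAt θ
      ((hline r₀ r₁).prodMk (hline e₀ e₁))
    refine h1.congr_deriv ?_
    have h2 : (r₁ - r₀, e₁ - e₀) = (r₁ - r₀) • ((1 : ℝ), (0 : ℝ)) + (e₁ - e₀) • ((0 : ℝ), (1 : ℝ)) := by
      simp
    rw [h2, map_add, map_smul, map_smul, hf.fRho_eq, hf.fEta_eq, smul_eq_mul, smul_eq_mul]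
    ring
  have hc : ∀ {g : ℝ → ℝ → ℝ}, (Continuous fun p : ℝ × ℝ => g p.1 p.2) →
      Continuous fun θ : ℝ => g (r₀ + θ * (r₁ - r₀)) (e₀ + θ * (e₁ - e₀)) := fun hg =>
    hg.comp (f := fun θ : ℝ => (r₀ + θ * (r₁ - r₀), e₀ + θ * (e₁ - e₀))) (by fun_prop)
  have h1 := (hc hf.continuous_fRho).mul_const (r₁ - r₀)
  have h2 := (hc hf.continuous_fEta).mul_const (e₁ - e₀)
  have h3 := intervalIntegral.integral_eq_sub_of_hasDerivAt hd
    ((h1.add h2).intervalIntegrable _ _)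
  rw [intervalIntegral.integral_add (h1.intervalIntegrable _ _) (h2.intervalIntegrable _ _),
    intervalIntegral.integral_mul_const, intervalIntegral.integral_mul_const] at h3
  simp only [segAvg, h3]
  simp

end Model

namespace Grid

variable {d : ℕ} {G : Grid d} {h : ℝ}

/-! ### Linear functionals with coefficients depending on jets. -/

section JetForm

variable {ι : Type*} [Fintype ι]

/-- The linear functional `v ↦ ∫ a v + b · ∇v`, where `a` and `b` are continuous functions of the
finite element functions `W` and their gradients. -/
def jetForm (hG : G.IsMesh h) (a : C((ι → ℝ × E d), ℝ)) (b : C((ι → ℝ × E d), E d))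
    (W : ι → G.Vh) : G.Vh →ₗ[ℝ] ℝ where
  toFun v := ∫ x in G.Om, (a (fun i => jet (W i) x) * v.1 x
    + inner ℝ (b fun i => jet (W i) x) (gradient v.1 x))
  map_add' u v := by
    rw [← integral_add]
    · refine integral_congr_ae ?_
      filter_upwards [ae_mem_cellInteriors hG] with x hx
      rw [gradient_add_of_mem _ _ hx, inner_add_right]
      simp only [Submodule.coe_add, Pi.add_apply]
      ring
    -- The test function is adjoined to the fields `W` as the extra index `none`.
    · exact integrableOn_comp_jet hG
        (Φ := fun p : Option ι → ℝ × E d => a (fun i => p (some i)) * (p none).1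
          + inner ℝ (b fun i => p (some i)) (p none).2)
        (by fun_prop) (fun i => i.elim u W)
    · exact integrableOn_comp_jet hG
        (Φ := fun p : Option ι → ℝ × E d => a (fun i => p (some i)) * (p none).1
          + inner ℝ (b fun i => p (some i)) (p none).2)
        (by fun_prop) (fun i => i.elim v W)
  map_smul' c v := by
    rw [RingHom.id_apply, smul_eq_mul, ← integral_const_mul]
    refine integral_congr_ae ?_
    filter_upwards [ae_mem_cellInteriors hG] with x hx
    rw [gradient_smul_of_mem _ _ hx, inner_smul_right]
    simp only [Submodule.coe_smul, Pi.smul_apply, smul_eq_mul]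
    ring

variable (hG : G.IsMesh h) (a : C((ι → ℝ × E d), ℝ)) (b : C((ι → ℝ × E d), E d))

theorem jetForm_apply (W : ι → G.Vh) (v : G.Vh) :
    jetForm hG a b W v = ∫ x in G.Om, (a (fun i => jet (W i) x) * v.1 x
      + inner ℝ (b fun i => jet (W i) x) (gradient v.1 x)) := rfl

theorem integrableOn_jetForm {h : ℝ} (hG : G.IsMesh h) (a : C((ι → ℝ × E d), ℝ))
    (b : C((ι → ℝ × E d), E d)) (W : ι → G.Vh) (v : G.Vh) :
    IntegrableOn (fun x => a (fun i => jet (W i) x) * v.1 x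
      + inner ℝ (b fun i => jet (W i) x) (gradient v.1 x)) G.Om :=
  integrableOn_comp_jet hG
    (Φ := fun p : Option ι → ℝ × E d => a (fun i => p (some i)) * (p none).1
      + inner ℝ (b fun i => p (some i)) (p none).2)
    (by fun_prop) (fun i => i.elim v W)

theorem jetForm_eq_add (W : ι → G.Vh) (v : G.Vh) :
    jetForm hG a b W v = (∫ x in G.Om, a (fun i => jet (W i) x) * v.1 x)
      + ∫ x in G.Om, inner ℝ (b fun i => jet (W i) x) (gradient v.1 x) := by
  rw [jetForm_apply, integral_add]
  · exact integrableOn_comp_jet hG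
      (Φ := fun p : Option ι → ℝ × E d => a (fun i => p (some i)) * (p none).1)
      (by fun_prop) (fun i => i.elim v W)
  · exact integrableOn_comp_jet hG
      (Φ := fun p : Option ι → ℝ × E d => inner ℝ (b fun i => p (some i)) (p none).2)
      (by fun_prop) (fun i => i.elim v W)

theorem continuous_jetForm (hside : 0 < G.side) (v : G.Vh) :
    Continuous fun W : ι → G.Vh => jetForm hG a b W v := by
  have h1 := continuous_integral_comp_jet hG hside
    (Φ := fun p : Option ι → ℝ × E d => a (fun i => p (some i)) * (p none).1
      + inner ℝ (b fun i => p (some i)) (p none).2) (by fun_prop)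
  refine h1.comp (g := fun W : Option ι → G.Vh => _) (f := fun W : ι → G.Vh =>
    (fun i => i.elim v W : Option ι → G.Vh)) (continuous_pi fun i => ?_)
  cases i with
  | none => exact continuous_const
  | some i => exact continuous_apply i

end JetForm

end Grid

/-! ### One time step and its energy identity. -/

open Model

/-- The argument of the mobility matrix assembled from two jets. -/
def jetState {d : ℕ} (p q : ℝ × E d) : State d := (p.1, q.1, p.2, q.2)

/-- The midpoint in time of the state, for fields `(ρ⁰, ρ¹, η⁰, η¹, μ_ρ, μ_η)`. -/
def midState {d : ℕ} (p : Fin 6 → ℝ × E d) : State d :=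
  jetState ((1 / 2 : ℝ) • (p 0 + p 1)) ((1 / 2 : ℝ) • (p 2 + p 3))

namespace Grid

variable {d : ℕ} {G : Grid d} {h : ℝ} {M : Model d}

theorem continuous_midState : Continuous (midState (d := d)) := by
  unfold midState jetState
  fun_prop

theorem continuous_flux (hL : M.GoodMobility) : Continuous fun p : Fin 6 → ℝ × E d =>
    M.L11 (midState p) (p 4).2 + (p 5).1 • M.L12 (midState p) := by
  have h1 : Continuous fun p : Fin 6 → ℝ × E d => M.L11 (midState p) (p 4).2 :=
    hL.continuous_L11.comp (continuous_midState.prodMk (by fun_prop))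
  have h2 := hL.continuous_L12.comp (continuous_midState (d := d))
  have h3 : Continuous fun p : Fin 6 → ℝ × E d => (p 5).1 := by fun_prop
  exact h1.add (h3.smul h2)

theorem continuous_reaction (hL : M.GoodMobility) : Continuous fun p : Fin 6 → ℝ × E d =>
    inner ℝ (M.L12 (midState p)) (p 4).2 + M.L22 (midState p) * (p 5).1 := by
  have h2 := hL.continuous_L12.comp (continuous_midState (d := d))
  have h3 := hL.continuous_L22.comp (continuous_midState (d := d))
  exact (h2.inner (by fun_prop)).add (h3.mul (by fun_prop))

theorem continuous_segAvg_fields {g : ℝ → ℝ → ℝ} (hg : Continuous fun p : ℝ × ℝ => g p.1 p.2) :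
    Continuous fun p : Fin 6 → ℝ × E d => segAvg g (p 0).1 (p 1).1 (p 2).1 (p 3).1 :=
  continuous_segAvg hg (by fun_prop) (by fun_prop) (by fun_prop) (by fun_prop)

/-- The residual of the mass balance in one time step. -/
def massForm (hG : G.IsMesh h) (hL : M.GoodMobility) (τ : ℝ) :
    (Fin 6 → G.Vh) → G.Vh →ₗ[ℝ] ℝ :=
  jetForm hG ⟨fun p => (p 1).1 - (p 0).1, by fun_prop⟩
    ⟨fun p => τ • (M.L11 (midState p) (p 4).2 + (p 5).1 • M.L12 (midState p)),
      (continuous_flux hL).const_smul τ⟩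

/-- The residual of the order parameter equation in one time step. -/
def orderForm (hG : G.IsMesh h) (hL : M.GoodMobility) (τ : ℝ) :
    (Fin 6 → G.Vh) → G.Vh →ₗ[ℝ] ℝ :=
  jetForm hG ⟨fun p => (p 3).1 - (p 2).1
      + τ * (inner ℝ (M.L12 (midState p)) (p 4).2 + M.L22 (midState p) * (p 5).1),
    Continuous.add (by fun_prop) ((continuous_reaction hL).const_mul τ)⟩ ⟨fun _ => 0, by fun_prop⟩

/-- The negative residual of the equation for `μ_ρ` in one time step. -/
def potRhoForm (hG : G.IsMesh h) (hf : M.GoodPotential) :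
    (Fin 6 → G.Vh) → G.Vh →ₗ[ℝ] ℝ :=
  jetForm hG ⟨fun p => segAvg M.fRho (p 0).1 (p 1).1 (p 2).1 (p 3).1 - (p 4).1,
    (continuous_segAvg_fields hf.continuous_fRho).sub (by fun_prop)⟩
    ⟨fun p => M.gammaRho • (1 / 2 : ℝ) • ((p 0).2 + (p 1).2), by fun_prop⟩

/-- The negative residual of the equation for `μ_η` in one time step. -/
def potEtaForm (hG : G.IsMesh h) (hf : M.GoodPotential) :
    (Fin 6 → G.Vh) → G.Vh →ₗ[ℝ] ℝ :=
  jetForm hG ⟨fun p => segAvg M.fEta (p 0).1 (p 1).1 (p 2).1 (p 3).1 - (p 5).1,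
    (continuous_segAvg_fields hf.continuous_fEta).sub (by fun_prop)⟩
    ⟨fun p => M.gammaEta • (1 / 2 : ℝ) • ((p 2).2 + (p 3).2), by fun_prop⟩

/-- One time step of the scheme from `(W 0, W 2)` to `(W 1, W 3)`, with chemical potentials
`(W 4, W 5)`. -/
structure IsStep (hG : G.IsMesh h) (hL : M.GoodMobility) (hf : M.GoodPotential) (τ : ℝ)
    (W : Fin 6 → G.Vh) : Prop where
  mass : massForm hG hL τ W = 0
  order : orderForm hG hL τ W = 0
  potRho : potRhoForm hG hf W = 0
  potEta : potEtaForm hG hf W = 0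

/-- The rate of dissipation at a point. -/
def dissipationDensity (M : Model d) (p : Fin 6 → ℝ × E d) : ℝ :=
  forceVec (p 4).2 (p 5).1 ⬝ᵥ (M.L (midState p) *ᵥ forceVec (p 4).2 (p 5).1)

theorem dissipationDensity_eq (hL : M.GoodMobility) (p : Fin 6 → ℝ × E d) :
    dissipationDensity M p =
      inner ℝ (M.L11 (midState p) (p 4).2 + (p 5).1 • M.L12 (midState p)) (p 4).2
      + (inner ℝ (M.L12 (midState p)) (p 4).2 + M.L22 (midState p) * (p 5).1) * (p 5).1 :=
  (inner_blocks_eq hL _ _ _ _ _).symm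

theorem continuous_dissipationDensity (hL : M.GoodMobility) :
    Continuous (dissipationDensity M) := by
  simp only [funext (dissipationDensity_eq hL)]
  exact ((continuous_flux hL).inner (by fun_prop)).add
    ((continuous_reaction hL).mul (by fun_prop))

/-- The density of the free energy. -/
def energyDensity (M : Model d) (p q : ℝ × E d) : ℝ :=
  M.gammaRho / 2 * ‖p.2‖ ^ 2 + M.gammaEta / 2 * ‖q.2‖ ^ 2 + M.f p.1 q.1

theorem energy_eq (ρ η : G.Vh) :
    G.energy M ρ.1 η.1 = ∫ x in G.Om, energyDensity M (jet ρ x) (jet η x) := rfl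

theorem integrableOn_energyDensity (hG : G.IsMesh h) (hf : M.GoodPotential) (ρ η : G.Vh) :
    IntegrableOn (fun x => energyDensity M (jet ρ x) (jet η x)) G.Om := by
  have h1 : Continuous fun p : Fin 2 → ℝ × E d => M.f (p 0).1 (p 1).1 :=
    hf.contDiff.continuous.comp (f := fun p : Fin 2 → ℝ × E d => ((p 0).1, (p 1).1)) (by fun_prop)
  refine integrableOn_comp_jet hG (ι := Fin 2)
    (Φ := fun p => energyDensity M (p 0) (p 1)) ?_ ![ρ, η]
  unfold energyDensity
  fun_prop

theorem integrableOn_dissipationDensity (hG : G.IsMesh h) (hL : M.GoodMobility)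
    (W : Fin 6 → G.Vh) :
    IntegrableOn (fun x => dissipationDensity M fun i => jet (W i) x) G.Om :=
  integrableOn_comp_jet hG (continuous_dissipationDensity hL) W

/-- The discrete energy-dissipation identity for the residuals. -/
theorem forms_sum_eq (hG : G.IsMesh h) (hL : M.GoodMobility) (hf : M.GoodPotential) (τ : ℝ)
    (W : Fin 6 → G.Vh) :
    massForm hG hL τ W (W 4) + orderForm hG hL τ W (W 5)
      + potRhoForm hG hf W (W 1 - W 0) + potEtaForm hG hf W (W 3 - W 2)
      = τ * (∫ x in G.Om, dissipationDensity M fun i => jet (W i) x)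
        + G.energy M (W 1).1 (W 3).1 - G.energy M (W 0).1 (W 2).1 := by
  simp only [massForm, orderForm, potRhoForm, potEtaForm, jetForm_apply, energy_eq]
  rw [← integral_add, ← integral_add, ← integral_add, ← integral_const_mul, ← integral_add,
    ← integral_sub]
  · refine integral_congr_ae ?_
    filter_upwards [ae_mem_cellInteriors hG] with x hx
    have hj : ∀ u v : G.Vh, gradient (u - v).1 x = gradient u.1 x - gradient v.1 x :=
      fun u v => congrArg Prod.snd (jet_sub_of_mem u v hx)
    have hv : ∀ u v : G.Vh, (u - v).1 x = u.1 x - v.1 x := fun _ _ => rfl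
    have hE := hf.sub_eq_segAvg ((W 0).1 x) ((W 1).1 x) ((W 2).1 x) ((W 3).1 x)
    -- The midpoint gradient tested with the gradient of the increment is a difference of squares.
    have hq : ∀ u v : E d, inner ℝ (u + v) (v - u) = ‖v‖ ^ 2 - ‖u‖ ^ 2 := by
      intro u v
      rw [inner_add_left, inner_sub_right, inner_sub_right, real_inner_self_eq_norm_sq,
        real_inner_self_eq_norm_sq, real_inner_comm]
      ring
    simp only [ContinuousMap.coe_mk, dissipationDensity_eq hL, energyDensity, hj, hv,
      real_inner_smul_left, hq, inner_zero_left, jet] at hE ⊢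
    -- The products of the potentials with the increments occur twice with opposite signs; `hE`
    -- converts the segment averages into the increment of `f`.
    linear_combination -hE
  · exact ((integrableOn_dissipationDensity hG hL W).const_mul τ).add
      (integrableOn_energyDensity hG hf _ _)
  · exact integrableOn_energyDensity hG hf _ _
  · exact (integrableOn_dissipationDensity hG hL W).const_mul τ
  · exact integrableOn_energyDensity hG hf _ _
  · exact ((integrableOn_jetForm hG _ _ W _).add (integrableOn_jetForm hG _ _ W _)).add
      (integrableOn_jetForm hG _ _ W _)
  · exact integrableOn_jetForm hG _ _ W _
  · exact (integrableOn_jetForm hG _ _ W _).add (integrableOn_jetForm hG _ _ W _)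
  · exact integrableOn_jetForm hG _ _ W _
  · exact integrableOn_jetForm hG _ _ W _
  · exact integrableOn_jetForm hG _ _ W _

theorem IsStep.energy_sub {hG : G.IsMesh h} {hL : M.GoodMobility} {hf : M.GoodPotential} {τ : ℝ}
    {W : Fin 6 → G.Vh} (hW : IsStep hG hL hf τ W) :
    G.energy M (W 1).1 (W 3).1 - G.energy M (W 0).1 (W 2).1
      = -(τ * ∫ x in G.Om, dissipationDensity M fun i => jet (W i) x) := by
  have := forms_sum_eq hG hL hf τ W
  rw [hW.mass, hW.order, hW.potRho, hW.potEta] at this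
  simp only [LinearMap.zero_apply] at this
  linarith

/-! ### Means, mass, and functions determined by their gradients. -/

/-- The constant function one. -/
def oneVh (G : Grid d) : G.Vh :=
  ⟨fun _ => 1, continuous_const, fun _ _ => rfl, fun _ _ => ⟨1, by simp, by simp⟩⟩

theorem gradient_oneVh (x : E d) : gradient (oneVh G).1 x = 0 := gradient_fun_const x 1

/-- The integral over `Ω` as a linear functional. -/
def meanForm (hG : G.IsMesh h) : G.Vh →ₗ[ℝ] ℝ where
  toFun v := ∫ x in G.Om, v.1 x
  map_add' u v := integral_add (u.2.1.continuousOn.integrableOn_compact (isCompact_Om hG))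
    (v.2.1.continuousOn.integrableOn_compact (isCompact_Om hG))
  map_smul' c _ := integral_const_mul c _

theorem meanForm_apply (hG : G.IsMesh h) (v : G.Vh) : meanForm hG v = ∫ x in G.Om, v.1 x := rfl

/-- A constant test function does not see the flux. -/
theorem massForm_oneVh (hG : G.IsMesh h) (hL : M.GoodMobility) (τ : ℝ) (W : Fin 6 → G.Vh) :
    massForm hG hL τ W (oneVh G) = meanForm hG (W 1) - meanForm hG (W 0) := by
  rw [← map_sub, meanForm_apply, massForm, jetForm_apply]
  simp only [gradient_oneVh, inner_zero_right, add_zero]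
  refine integral_congr_ae (Filter.Eventually.of_forall fun x => ?_)
  exact mul_one _

theorem volume_Om_ne_zero (hside : 0 < G.side) : volume G.Om ≠ 0 := by
  have hopen : IsOpen {x : E d | ∀ i, x i ∈ Ioo (G.corner i) (G.corner i + G.side)} := by
    simp only [ofPred_forall]
    exact isOpen_iInter_of_finite fun i => isOpen_Ioo.preimage (by fun_prop)
  have hne : {x : E d | ∀ i, x i ∈ Ioo (G.corner i) (G.corner i + G.side)}.Nonempty := by
    refine ⟨WithLp.toLp 2 fun i => G.corner i + G.side / 2, fun i => ?_⟩
    constructor <;> simp [hside]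
  have hpos := hopen.measure_pos volume hne
  exact (hpos.trans_le (measure_mono fun x hx i => Ioo_subset_Icc_self (hx i))).ne'

theorem meanForm_oneVh_pos (hG : G.IsMesh h) (hside : 0 < G.side) :
    0 < meanForm hG (oneVh G) := by
  rw [meanForm_apply]
  simp only [oneVh, integral_const, smul_eq_mul, mul_one]
  rw [Measure.real, Measure.restrict_apply_univ]
  exact ENNReal.toReal_pos (volume_Om_ne_zero hside) (isCompact_Om hG).measure_lt_top.ne

theorem eq_zero_of_ae_eq_zero (hG : G.IsMesh h) (hside : 0 < G.side) (v : G.Vh)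
    (hv : ∀ᵐ x ∂(volume.restrict G.Om), v.1 x = 0) : v = 0 := by
  have hU : G.cellInteriors ⊆ G.Om := iUnion₂_subset fun K hK =>
    interior_subset.trans (simplex_subset_Om hG hK)
  have hzero : EqOn v.1 (fun _ => 0) G.cellInteriors :=
    Measure.eqOn_open_of_ae_eq (ae_restrict_of_ae_restrict_of_subset hU hv)
      isOpen_cellInteriors v.2.1.continuousOn continuousOn_const
  have hgrad : ∀ᵐ x ∂(volume.restrict G.Om), gradient v.1 x = 0 := by
    filter_upwards [ae_mem_cellInteriors hG] with x hx
    rw [(hzero.eventuallyEq_of_mem (isOpen_cellInteriors.mem_nhds hx)).gradient_eq]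
    exact gradient_fun_const x 0
  have hne : (ae (volume.restrict G.Om)).NeBot := by
    rw [ae_neBot, Ne, Measure.restrict_eq_zero]
    exact volume_Om_ne_zero hside
  obtain ⟨y, hy, hyO⟩ := (hv.and (ae_restrict_mem (isCompact_Om hG).measurableSet)).exists
  exact eq_zero_of_eqOn_Om hside v fun x hx =>
    (eq_of_gradient_eq_zero hG v hgrad hx hyO).trans hy

/-- Makes the gradient seminorm a norm on mean-free functions: the constant value of `v`, times the
volume of `Ω`, is its mean integral. -/
theorem eq_zero_of_gradient_eq_zero_of_mean (hG : G.IsMesh h) (hside : 0 < G.side) (v : G.Vh)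
    (hv : ∀ᵐ x ∂(volume.restrict G.Om), gradient v.1 x = 0) (hmean : meanForm hG v = 0) :
    v = 0 := by
  refine eq_zero_of_eqOn_Om hside v fun x hx => ?_
  have h1 : meanForm hG v = v.1 x * meanForm hG (oneVh G) := by
    rw [meanForm_apply, meanForm_apply, ← integral_const_mul]
    refine setIntegral_congr_fun (isCompact_Om hG).measurableSet fun y hy => ?_
    simp only [oneVh, mul_one]
    exact eq_of_gradient_eq_zero hG v hv hy hx
  rw [hmean] at h1
  exact (mul_eq_zero.1 h1.symm).resolve_right (meanForm_oneVh_pos hG hside).ne'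

/-! ### The normalized system and its coercivity. -/

/-- The finite element functions with vanishing mean. -/
abbrev meanFree (hG : G.IsMesh h) : Submodule ℝ G.Vh := LinearMap.ker (meanForm hG)

/-- The unknowns `(ρ¹ - ρ⁰, η¹ - η⁰, μ_ρ, μ_η)` of one time step, with `μ_ρ` normalized to have
vanishing mean. -/
abbrev Unknowns (hG : G.IsMesh h) : Type := meanFree hG × G.Vh × meanFree hG × G.Vh

/-- The six fields of a time step from `(ρ⁰, η⁰)` with given unknowns. -/
def fields (hG : G.IsMesh h) (ρ₀ η₀ : G.Vh) (y : Unknowns hG) : Fin 6 → G.Vh :=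
  ![ρ₀, ρ₀ + y.1, η₀, η₀ + y.2.1, y.2.2.1, y.2.2.2]

theorem continuous_fields (hG : G.IsMesh h) (ρ₀ η₀ : G.Vh) :
    Continuous (fields hG ρ₀ η₀) := by
  refine continuous_pi fun i => ?_
  fin_cases i <;> simp [fields] <;> fun_prop

/-- The residual of one time step. -/
def residual (hG : G.IsMesh h) (hL : M.GoodMobility) (hf : M.GoodPotential) (τ : ℝ)
    (ρ₀ η₀ : G.Vh) (y : Unknowns hG) : Unknowns hG →ₗ[ℝ] ℝ :=
  ((massForm hG hL τ (fields hG ρ₀ η₀ y)).comp (meanFree hG).subtype).coprod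
    ((orderForm hG hL τ (fields hG ρ₀ η₀ y)).coprod
      (((potRhoForm hG hf (fields hG ρ₀ η₀ y)).comp (meanFree hG).subtype).coprod
        (potEtaForm hG hf (fields hG ρ₀ η₀ y))))

theorem residual_apply (hG : G.IsMesh h) (hL : M.GoodMobility) (hf : M.GoodPotential) (τ : ℝ)
    (ρ₀ η₀ : G.Vh) (y z : Unknowns hG) :
    residual hG hL hf τ ρ₀ η₀ y z = massForm hG hL τ (fields hG ρ₀ η₀ y) z.1
      + (orderForm hG hL τ (fields hG ρ₀ η₀ y) z.2.1
        + (potRhoForm hG hf (fields hG ρ₀ η₀ y) z.2.2.1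
          + potEtaForm hG hf (fields hG ρ₀ η₀ y) z.2.2.2)) := rfl

/-- The linear map giving the test functions `(μ_ρ, μ_η + δ (η¹ - η⁰), ρ¹ - ρ⁰, η¹ - η⁰)`. -/
def testMap (hG : G.IsMesh h) (δ : ℝ) : Unknowns hG →ₗ[ℝ] Unknowns hG where
  toFun y := (y.2.2.1, y.2.2.2 + δ • y.2.1, y.1, y.2.1)
  map_add' y z := by
    ext1
    · rfl
    · ext1
      · simp only [Prod.snd_add, Prod.fst_add]
        module
      · rfl
  map_smul' c y := by
    ext1
    · rfl
    · ext1
      · simp only [Prod.smul_snd, Prod.smul_fst, RingHom.id_apply]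
        module
      · rfl

/-- Up to a shear the map only permutes the unknowns into the matching test slots, so an inverse can
be written down. -/
theorem testMap_surjective (hG : G.IsMesh h) (δ : ℝ) : Function.Surjective (testMap hG δ) := by
  rintro ⟨a, b, c, e⟩
  exact ⟨(c, e, a, b - δ • e), by simp [testMap]⟩

/-- The density of the quadratic form that measures the unknowns of a time step. -/
def sizeDensity (c₁ c₂ c₃ : ℝ) (p : Fin 4 → ℝ × E d) : ℝ :=
  c₁ * (‖(p 2).2‖ ^ 2 + (p 3).1 ^ 2) + c₂ * (p 1).1 ^ 2 + c₃ * ‖(p 0).2‖ ^ 2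

theorem continuous_sizeDensity (c₁ c₂ c₃ : ℝ) : Continuous (sizeDensity (d := d) c₁ c₂ c₃) := by
  unfold sizeDensity
  fun_prop

/-- The unknowns of a time step as a family of finite element functions. -/
def components (hG : G.IsMesh h) (y : Unknowns hG) : Fin 4 → G.Vh :=
  ![y.1, y.2.1, y.2.2.1, y.2.2.2]

theorem continuous_components (hG : G.IsMesh h) : Continuous (components hG) := by
  refine continuous_pi fun i => ?_
  fin_cases i <;> simp [components] <;> fun_prop

/-- A quadratic form that measures the unknowns of a time step. -/
def sizeForm (hG : G.IsMesh h) (c₁ c₂ c₃ : ℝ) (y : Unknowns hG) : ℝ :=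
  ∫ x in G.Om, sizeDensity c₁ c₂ c₃ fun i => jet (components hG y i) x

theorem sizeForm_smul (hG : G.IsMesh h) (c₁ c₂ c₃ c : ℝ) (y : Unknowns hG) :
    sizeForm hG c₁ c₂ c₃ (c • y) = c ^ 2 * sizeForm hG c₁ c₂ c₃ y := by
  rw [sizeForm, sizeForm, ← integral_const_mul]
  refine integral_congr_ae ?_
  filter_upwards [ae_mem_cellInteriors hG] with x hx
  have h1 : ∀ i, jet (components hG (c • y) i) x = c • jet (components hG y i) x := by
    intro i
    rw [← jet_smul_of_mem c _ hx]
    fin_cases i <;> rfl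
  simp only [sizeDensity, h1, Prod.smul_fst, Prod.smul_snd, norm_smul, mul_pow, Real.norm_eq_abs,
    sq_abs, smul_eq_mul]
  ring

/-- Gradients suffice for the first and third component because these are mean-free; the other two
enter by value. -/
theorem sizeForm_pos (hG : G.IsMesh h) (hside : 0 < G.side) {c₁ c₂ c₃ : ℝ} (h₁ : 0 < c₁)
    (h₂ : 0 < c₂) (h₃ : 0 < c₃) (y : Unknowns hG) (hy : y ≠ 0) :
    0 < sizeForm hG c₁ c₂ c₃ y := by
  have hnn : ∀ p : Fin 4 → ℝ × E d, 0 ≤ sizeDensity c₁ c₂ c₃ p := fun p => by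
    unfold sizeDensity
    positivity
  refine lt_of_le_of_ne (integral_nonneg fun x => hnn _) fun h0 => hy ?_
  have h1 := (integral_eq_zero_iff_of_nonneg (fun x => hnn _)
    (integrableOn_comp_jet hG (continuous_sizeDensity c₁ c₂ c₃) (components hG y))).1 h0.symm
  have h2 : ∀ᵐ x ∂(volume.restrict G.Om), gradient y.2.2.1.1.1 x = 0 ∧ y.2.2.2.1 x = 0 ∧
      y.2.1.1 x = 0 ∧ gradient y.1.1.1 x = 0 := by
    filter_upwards [h1] with x hx
    have hx' : c₁ * (‖gradient y.2.2.1.1.1 x‖ ^ 2 + y.2.2.2.1 x ^ 2) + c₂ * y.2.1.1 x ^ 2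
      + c₃ * ‖gradient y.1.1.1 x‖ ^ 2 = 0 := hx
    have a1 : 0 ≤ c₁ * ‖gradient y.2.2.1.1.1 x‖ ^ 2 := by positivity
    have a2 : 0 ≤ c₁ * y.2.2.2.1 x ^ 2 := by positivity
    have a3 : 0 ≤ c₂ * y.2.1.1 x ^ 2 := by positivity
    have a4 : 0 ≤ c₃ * ‖gradient y.1.1.1 x‖ ^ 2 := by positivity
    have b1 : c₁ * ‖gradient y.2.2.1.1.1 x‖ ^ 2 = 0 := by linarith
    have b2 : c₁ * y.2.2.2.1 x ^ 2 = 0 := by linarith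
    have b3 : c₂ * y.2.1.1 x ^ 2 = 0 := by linarith
    have b4 : c₃ * ‖gradient y.1.1.1 x‖ ^ 2 = 0 := by linarith
    exact ⟨by simpa [h₁.ne'] using b1, by simpa [h₁.ne'] using b2, by simpa [h₂.ne'] using b3,
      by simpa [h₃.ne'] using b4⟩
  have e1 := eq_zero_of_gradient_eq_zero_of_mean hG hside y.1.1 (h2.mono fun x hx => hx.2.2.2)
    y.1.2
  have e2 := eq_zero_of_ae_eq_zero hG hside y.2.1 (h2.mono fun x hx => hx.2.2.1)
  have e3 := eq_zero_of_gradient_eq_zero_of_mean hG hside y.2.2.1.1 (h2.mono fun x hx => hx.1)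
    y.2.2.1.2
  have e4 := eq_zero_of_ae_eq_zero hG hside y.2.2.2 (h2.mono fun x hx => hx.2.1)
  exact Prod.ext (Subtype.ext e1) (Prod.ext e2 (Prod.ext (Subtype.ext e3) e4))

/-- `forms_sum_eq` supplies `τ` times the dissipation plus the new energy, and the extra test
function `δ (η¹ - η⁰)` supplies `δ |η¹ - η⁰|²` together with a cross term. Half of the dissipation
absorbs that cross term, which is where `δ τ lam2 ≤ 1` enters; the other half yields the coefficient
`τ lam1 / 2`. -/
theorem residual_coercive (hG : G.IsMesh h) (hγ : M.PosInterface) (hL : M.GoodMobility)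
    (hf : M.GoodPotential) {τ : ℝ} (hτ : 0 < τ) (ρ₀ η₀ : G.Vh) {lam1 lam2 : ℝ} (h1 : 0 < lam1)
    (hb : ∀ (w : State d) (xi : Fin d ⊕ Unit → ℝ),
      lam1 * (xi ⬝ᵥ xi) ≤ xi ⬝ᵥ (M.L w *ᵥ xi) ∧ xi ⬝ᵥ (M.L w *ᵥ xi) ≤ lam2 * (xi ⬝ᵥ xi))
    {δ : ℝ} (hδ : 0 < δ) (hδ' : δ * τ * lam2 ≤ 1) (y : Unknowns hG) :
    sizeForm hG (τ * lam1 / 2) (δ / 2) (M.gammaRho / 4) y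
        - (G.energy M ρ₀.1 η₀.1 + ∫ x in G.Om, M.gammaRho / 2 * ‖(jet ρ₀ x).2‖ ^ 2)
      ≤ residual hG hL hf τ ρ₀ η₀ y (testMap hG δ y) := by
  set W := fields hG ρ₀ η₀ y with hW
  have hsum := forms_sum_eq hG hL hf τ W
  have hW1 : W 1 - W 0 = y.1 := add_sub_cancel_left _ _
  have hW3 : W 3 - W 2 = y.2.1 := add_sub_cancel_left _ _
  rw [hW1, hW3] at hsum
  have hres : residual hG hL hf τ ρ₀ η₀ y (testMap hG δ y)
      = τ * (∫ x in G.Om, dissipationDensity M fun i => jet (W i) x)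
        + G.energy M (W 1).1 (W 3).1 - G.energy M ρ₀.1 η₀.1
        + δ * orderForm hG hL τ W y.2.1 := by
    have h2 : G.energy M (W 0).1 (W 2).1 = G.energy M ρ₀.1 η₀.1 := rfl
    rw [← h2, ← hsum, residual_apply]
    simp only [testMap, LinearMap.coe_mk, AddHom.coe_mk, map_add, map_smul, smul_eq_mul]
    change massForm hG hL τ W (W 4) + (orderForm hG hL τ W (W 5) + _ + _) = _
    ring
  rw [hres]
  have hI0 : IntegrableOn (fun x => M.gammaRho / 2 * ‖(jet ρ₀ x).2‖ ^ 2) G.Om :=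
    integrableOn_comp_jet hG (ι := Unit)
      (Φ := fun p => M.gammaRho / 2 * ‖(p ()).2‖ ^ 2) (by fun_prop) fun _ => ρ₀
  have hIs := integrableOn_comp_jet hG
    (continuous_sizeDensity (τ * lam1 / 2) (δ / 2) (M.gammaRho / 4)) (components hG y)
  have hID := integrableOn_dissipationDensity hG hL W
  have hIE := integrableOn_energyDensity hG hf (W 1) (W 3)
  have hIDE : IntegrableOn (fun x => τ * (dissipationDensity M fun i => jet (W i) x)
      + energyDensity M (jet (W 1) x) (jet (W 3) x)) G.Om := (hID.const_mul τ).add hIE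
  have hOrd := integrableOn_jetForm hG
    (⟨fun p => (p 3).1 - (p 2).1
      + τ * (inner ℝ (M.L12 (midState p)) (p 4).2 + M.L22 (midState p) * (p 5).1),
      Continuous.add (by fun_prop) ((continuous_reaction hL).const_mul τ)⟩ : C(Fin 6 → ℝ × E d, ℝ))
    ⟨fun _ => 0, by fun_prop⟩ W y.2.1
  have key : sizeForm hG (τ * lam1 / 2) (δ / 2) (M.gammaRho / 4) y
      - ∫ x in G.Om, M.gammaRho / 2 * ‖(jet ρ₀ x).2‖ ^ 2
      ≤ τ * (∫ x in G.Om, dissipationDensity M fun i => jet (W i) x)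
        + G.energy M (W 1).1 (W 3).1 + δ * orderForm hG hL τ W y.2.1 := by
    rw [sizeForm, energy_eq, orderForm, jetForm_apply, ← integral_const_mul, ← integral_const_mul,
      ← integral_sub hIs hI0, ← integral_add (hID.const_mul τ) hIE,
      ← integral_add hIDE (hOrd.const_mul δ)]
    refine integral_mono_ae (hIs.sub hI0) (hIDE.add (hOrd.const_mul δ)) ?_
    filter_upwards [ae_mem_cellInteriors hG] with x hx
    have hr : gradient (W 1).1 x = gradient ρ₀.1 x + gradient y.1.1.1 x :=
      gradient_add_of_mem ρ₀ y.1.1 hx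
    have he : (W 3).1 x - (W 2).1 x = y.2.1.1 x := congrFun (congrArg Subtype.val hW3) x
    have hcs := hL.sq_last_row_le h1 hb (midState fun i => jet (W i) x)
      (gradient (W 4).1 x) ((W 5).1 x)
    have hlow := (hb (midState fun i => jet (W i) x)
      (forceVec (gradient (W 4).1 x) ((W 5).1 x))).1
    rw [forceVec_dotProduct_self] at hlow
    have hγρ := hγ.gammaRho_pos
    have hγη := hγ.gammaEta_pos
    have hfn := hf.nonneg ((W 1).1 x) ((W 3).1 x)
    -- Trades `γ_ρ/2 ‖∇ρ¹‖²` for `γ_ρ/4 ‖∇(ρ¹ - ρ⁰)‖²` at the cost of a term in the known `∇ρ⁰`.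
    have hpar : ‖gradient y.1.1.1 x‖ ^ 2
        ≤ 2 * ‖gradient (W 1).1 x‖ ^ 2 + 2 * ‖gradient ρ₀.1 x‖ ^ 2 := by
      have h3 : gradient y.1.1.1 x = gradient (W 1).1 x - gradient ρ₀.1 x := by rw [hr]; abel
      have h4 := norm_sub_le (gradient (W 1).1 x) (gradient ρ₀.1 x)
      rw [← h3] at h4
      have h5 := norm_nonneg (gradient y.1.1.1 x)
      nlinarith [sq_nonneg (‖gradient (W 1).1 x‖ - ‖gradient ρ₀.1 x‖)]
    simp only [ContinuousMap.coe_mk, inner_zero_left, add_zero]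
    change τ * lam1 / 2 * (‖gradient (W 4).1 x‖ ^ 2 + (W 5).1 x ^ 2) + δ / 2 * y.2.1.1 x ^ 2
        + M.gammaRho / 4 * ‖gradient y.1.1.1 x‖ ^ 2 - M.gammaRho / 2 * ‖gradient ρ₀.1 x‖ ^ 2
      ≤ τ * (forceVec (gradient (W 4).1 x) ((W 5).1 x) ⬝ᵥ
          (M.L (midState fun i => jet (W i) x) *ᵥ forceVec (gradient (W 4).1 x) ((W 5).1 x)))
        + (M.gammaRho / 2 * ‖gradient (W 1).1 x‖ ^ 2 + M.gammaEta / 2 * ‖gradient (W 3).1 x‖ ^ 2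
          + M.f ((W 1).1 x) ((W 3).1 x))
        + δ * (((W 3).1 x - (W 2).1 x + τ *
          (inner ℝ (M.L12 (midState fun i => jet (W i) x)) (gradient (W 4).1 x)
            + M.L22 (midState fun i => jet (W i) x) * (W 5).1 x)) * y.2.1.1 x)
    rw [he]
    generalize forceVec (gradient (W 4).1 x) ((W 5).1 x) ⬝ᵥ
      (M.L (midState fun i => jet (W i) x) *ᵥ forceVec (gradient (W 4).1 x) ((W 5).1 x)) = q
      at hcs hlow ⊢
    generalize inner ℝ (M.L12 (midState fun i => jet (W i) x)) (gradient (W 4).1 x)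
      + M.L22 (midState fun i => jet (W i) x) * (W 5).1 x = b at hcs ⊢
    generalize y.2.1.1 x = e
    have hq : 0 ≤ q := le_trans (by positivity) hlow
    have k1 : M.gammaRho / 4 * ‖gradient y.1.1.1 x‖ ^ 2 ≤ M.gammaRho / 4 *
      (2 * ‖gradient (W 1).1 x‖ ^ 2 + 2 * ‖gradient ρ₀.1 x‖ ^ 2) := by gcongr
    have k2 : 0 ≤ M.gammaEta / 2 * ‖gradient (W 3).1 x‖ ^ 2 := by positivity
    have k3 : τ / 2 * (lam1 * (‖gradient (W 4).1 x‖ ^ 2 + (W 5).1 x ^ 2)) ≤ τ / 2 * q := by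
      gcongr
    -- Young's inequality for the cross term `δ τ b e`: half of `δ e²` is kept, and `δ/2 τ² b²` is
    -- bounded by `τ/2 q` through `k5` and `k6`.
    have k4 : 0 ≤ δ / 2 * (e + τ * b) ^ 2 := by positivity
    have k5 : δ / 2 * τ ^ 2 * b ^ 2 ≤ δ / 2 * τ ^ 2 * (lam2 * q) := by gcongr
    have k6 : τ / 2 * q * (δ * τ * lam2) ≤ τ / 2 * q * 1 := by gcongr
    nlinarith
  linarith

/-! ### Solvability of a time step: from mean-free test functions to all of them. -/

theorem eq_zero_of_meanFree (hG : G.IsMesh h) (hside : 0 < G.side) (l : G.Vh →ₗ[ℝ] ℝ)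
    (h0 : ∀ v, meanForm hG v = 0 → l v = 0) (h1 : l (oneVh G) = 0) : l = 0 := by
  ext v
  have hpos := meanForm_oneVh_pos hG hside
  have h2 := h0 (v - (meanForm hG v / meanForm hG (oneVh G)) • oneVh G) (by
    rw [map_sub, map_smul, smul_eq_mul, div_mul_cancel₀ _ hpos.ne', sub_self])
  rw [map_sub, map_smul, h1, smul_zero, sub_zero] at h2
  simpa using h2

/-- The fields with a constant added to `μ_ρ`. -/
def shiftMuRho (W : Fin 6 → G.Vh) (c : ℝ) : Fin 6 → G.Vh :=
  Function.update W 4 (W 4 + c • oneVh G)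

theorem shiftMuRho_of_ne (W : Fin 6 → G.Vh) (c : ℝ) {i : Fin 6} (hi : i ≠ 4) :
    shiftMuRho W c i = W i := Function.update_of_ne hi _ _

theorem shiftMuRho_four (W : Fin 6 → G.Vh) (c : ℝ) :
    shiftMuRho W c 4 = W 4 + c • oneVh G := Function.update_self _ _ _

theorem gradient_shiftMuRho (W : Fin 6 → G.Vh) (c : ℝ) {x : E d} (hx : x ∈ G.cellInteriors) :
    gradient (shiftMuRho W c 4).1 x = gradient (W 4).1 x := by
  rw [shiftMuRho_four, gradient_add_of_mem _ _ hx, gradient_smul_of_mem _ _ hx, gradient_oneVh,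
    smul_zero, add_zero]

theorem midState_shiftMuRho (W : Fin 6 → G.Vh) (c : ℝ) (x : E d) :
    midState (fun i => jet (shiftMuRho W c i) x) = midState fun i => jet (W i) x := by
  simp only [midState, shiftMuRho_of_ne W c (show (0 : Fin 6) ≠ 4 by decide),
    shiftMuRho_of_ne W c (show (1 : Fin 6) ≠ 4 by decide),
    shiftMuRho_of_ne W c (show (2 : Fin 6) ≠ 4 by decide),
    shiftMuRho_of_ne W c (show (3 : Fin 6) ≠ 4 by decide)]

theorem massForm_shiftMuRho (hG : G.IsMesh h) (hL : M.GoodMobility) (τ : ℝ) (W : Fin 6 → G.Vh)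
    (c : ℝ) : massForm hG hL τ (shiftMuRho W c) = massForm hG hL τ W := by
  ext v
  rw [massForm, jetForm_apply, jetForm_apply]
  refine integral_congr_ae ?_
  filter_upwards [ae_mem_cellInteriors hG] with x hx
  simp only [ContinuousMap.coe_mk, midState_shiftMuRho]
  simp only [jet, gradient_shiftMuRho W c hx,
    shiftMuRho_of_ne W c (show (0 : Fin 6) ≠ 4 by decide),
    shiftMuRho_of_ne W c (show (1 : Fin 6) ≠ 4 by decide),
    shiftMuRho_of_ne W c (show (5 : Fin 6) ≠ 4 by decide)]

theorem orderForm_shiftMuRho (hG : G.IsMesh h) (hL : M.GoodMobility) (τ : ℝ) (W : Fin 6 → G.Vh)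
    (c : ℝ) : orderForm hG hL τ (shiftMuRho W c) = orderForm hG hL τ W := by
  ext v
  rw [orderForm, jetForm_apply, jetForm_apply]
  refine integral_congr_ae ?_
  filter_upwards [ae_mem_cellInteriors hG] with x hx
  simp only [ContinuousMap.coe_mk, midState_shiftMuRho]
  simp only [jet, gradient_shiftMuRho W c hx,
    shiftMuRho_of_ne W c (show (2 : Fin 6) ≠ 4 by decide),
    shiftMuRho_of_ne W c (show (3 : Fin 6) ≠ 4 by decide),
    shiftMuRho_of_ne W c (show (5 : Fin 6) ≠ 4 by decide)]

theorem potEtaForm_shiftMuRho (hG : G.IsMesh h) (hf : M.GoodPotential) (W : Fin 6 → G.Vh)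
    (c : ℝ) : potEtaForm hG hf (shiftMuRho W c) = potEtaForm hG hf W := by
  ext v
  rw [potEtaForm, jetForm_apply, jetForm_apply]
  simp only [ContinuousMap.coe_mk, shiftMuRho_of_ne W c (show (0 : Fin 6) ≠ 4 by decide),
    shiftMuRho_of_ne W c (show (1 : Fin 6) ≠ 4 by decide),
    shiftMuRho_of_ne W c (show (2 : Fin 6) ≠ 4 by decide),
    shiftMuRho_of_ne W c (show (3 : Fin 6) ≠ 4 by decide),
    shiftMuRho_of_ne W c (show (5 : Fin 6) ≠ 4 by decide)]

/-- The only one of the four forms that notices the shift, and only on test functions with nonzero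
mean; so the shift can enforce the equation for the test function one without disturbing the others.
-/
theorem potRhoForm_shiftMuRho (hG : G.IsMesh h) (hf : M.GoodPotential) (W : Fin 6 → G.Vh)
    (c : ℝ) (v : G.Vh) : potRhoForm hG hf (shiftMuRho W c) v
      = potRhoForm hG hf W v - c * meanForm hG v := by
  rw [meanForm_apply, ← integral_const_mul, potRhoForm, jetForm_apply, jetForm_apply,
    ← integral_sub (integrableOn_jetForm hG _ _ W v)
    ((v.2.1.continuousOn.integrableOn_compact (isCompact_Om hG)).const_mul c)]
  refine integral_congr_ae (Filter.Eventually.of_forall fun x => ?_)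
  have h4 : (shiftMuRho W c 4).1 x = (W 4).1 x + c * 1 := by rw [shiftMuRho_four]; rfl
  simp only [ContinuousMap.coe_mk, jet, shiftMuRho_of_ne W c (show (0 : Fin 6) ≠ 4 by decide),
    shiftMuRho_of_ne W c (show (1 : Fin 6) ≠ 4 by decide),
    shiftMuRho_of_ne W c (show (2 : Fin 6) ≠ 4 by decide),
    shiftMuRho_of_ne W c (show (3 : Fin 6) ≠ 4 by decide), h4]
  ring

theorem exists_residual_eq_zero (hG : G.IsMesh h) (hside : 0 < G.side) (hγ : M.PosInterface)
    (hL : M.GoodMobility) (hf : M.GoodPotential) {τ : ℝ} (hτ : 0 < τ) (ρ₀ η₀ : G.Vh) :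
    ∃ y : Unknowns hG, residual hG hL hf τ ρ₀ η₀ y = 0 := by
  obtain ⟨lam1, lam2, h1, hb⟩ := hL.bounds
  have hfin := finiteDimensional_Vh hG hside
  -- The choice of `δ`; no sign of `lam2` is assumed, and `|lam2| + 1` keeps the denominator
  -- positive.
  have hδ : 0 < 1 / (τ * (|lam2| + 1)) := by positivity
  have hδ' : 1 / (τ * (|lam2| + 1)) * τ * lam2 ≤ 1 := by
    have h2 : 1 / (τ * (|lam2| + 1)) * τ * lam2 = lam2 / (|lam2| + 1) := by field_simp
    rw [h2, div_le_one (by positivity)]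
    linarith [le_abs_self lam2]
  have hγρ := hγ.gammaRho_pos
  have hW := continuous_fields hG ρ₀ η₀
  refine exists_zero_of_coercive (residual hG hL hf τ ρ₀ η₀) (fun z => ?_)
    (testMap hG _) (testMap_surjective hG _)
    (sizeForm hG (τ * lam1 / 2) (1 / (τ * (|lam2| + 1)) / 2) (M.gammaRho / 4))
    ((continuous_integral_comp_jet hG hside (continuous_sizeDensity _ _ _)).comp
      (continuous_components hG))
    (fun c y => sizeForm_smul hG _ _ _ c y)
    (fun y hy => sizeForm_pos hG hside (by positivity) (by positivity) (by positivity) y hy)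
    _ (residual_coercive hG hγ hL hf hτ ρ₀ η₀ h1 hb hδ hδ')
  simp only [residual_apply]
  exact ((continuous_jetForm hG _ _ hside _).comp hW).add
    (((continuous_jetForm hG _ _ hside _).comp hW).add
      (((continuous_jetForm hG _ _ hside _).comp hW).add
        ((continuous_jetForm hG _ _ hside _).comp hW)))

/-- Every time step of the scheme is solvable. -/
theorem exists_isStep (hG : G.IsMesh h) (hside : 0 < G.side) (hγ : M.PosInterface)
    (hL : M.GoodMobility) (hf : M.GoodPotential) {τ : ℝ} (hτ : 0 < τ) (ρ₀ η₀ : G.Vh) :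
    ∃ W, W 0 = ρ₀ ∧ W 2 = η₀ ∧ IsStep hG hL hf τ W := by
  obtain ⟨y, hy⟩ := exists_residual_eq_zero hG hside hγ hL hf hτ ρ₀ η₀
  have hz : ∀ z : Unknowns hG, massForm hG hL τ (fields hG ρ₀ η₀ y) z.1
      + (orderForm hG hL τ (fields hG ρ₀ η₀ y) z.2.1
      + (potRhoForm hG hf (fields hG ρ₀ η₀ y) z.2.2.1
        + potEtaForm hG hf (fields hG ρ₀ η₀ y) z.2.2.2)) = 0 := fun z => by
    rw [← residual_apply, hy, LinearMap.zero_apply]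
  have hW10 : fields hG ρ₀ η₀ y 1 - fields hG ρ₀ η₀ y 0 = y.1 := add_sub_cancel_left _ _
  have hW0 : fields hG ρ₀ η₀ y 0 = ρ₀ := rfl
  have hW2 : fields hG ρ₀ η₀ y 2 = η₀ := rfl
  generalize fields hG ρ₀ η₀ y = W at hz hW10 hW0 hW2
  have hmass : ∀ v, meanForm hG v = 0 → massForm hG hL τ W v = 0 := fun v hv => by
    simpa using hz (⟨v, hv⟩, 0, 0, 0)
  have horder : ∀ v, orderForm hG hL τ W v = 0 := fun v => by
    simpa using hz (0, v, 0, 0)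
  have hpotRho : ∀ v, meanForm hG v = 0 → potRhoForm hG hf W v = 0 := fun v hv => by
    simpa using hz (0, 0, ⟨v, hv⟩, 0)
  have hpotEta : ∀ v, potEtaForm hG hf W v = 0 := fun v => by
    simpa using hz (0, 0, 0, v)
  have hpos := meanForm_oneVh_pos hG hside
  -- The constant for which the `μ_ρ` equation holds with test function one.
  refine ⟨shiftMuRho W (potRhoForm hG hf W (oneVh G) / meanForm hG (oneVh G)), ?_, ?_,
    ?_, ?_, ?_, ?_⟩
  · rw [shiftMuRho_of_ne _ _ (by decide), hW0]
  · rw [shiftMuRho_of_ne _ _ (by decide), hW2]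
  · rw [massForm_shiftMuRho]
    refine eq_zero_of_meanFree hG hside _ hmass ?_
    -- For the mass balance the constant test function costs nothing, since the increment `y.1` is
    -- mean-free.
    rw [massForm_oneVh, ← map_sub, hW10]
    exact y.1.2
  · rw [orderForm_shiftMuRho]
    exact LinearMap.ext horder
  · refine eq_zero_of_meanFree hG hside _ (fun v hv => ?_) ?_
    · rw [potRhoForm_shiftMuRho, hpotRho v hv, hv, mul_zero, sub_zero]
    · rw [potRhoForm_shiftMuRho, div_mul_cancel₀ _ hpos.ne', sub_self]
  · rw [potEtaForm_shiftMuRho]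
    exact LinearMap.ext hpotEta

/-! ### Time integrals of affine and constant functions on one interval. -/

section Time

theorem t_eq_add {n : ℕ} (hn : 1 ≤ n) : G.t n = G.t (n - 1) + G.tau := by
  obtain ⟨m, rfl⟩ := Nat.exists_eq_add_of_le' hn
  simp only [t, Nat.add_sub_cancel, Nat.cast_add, Nat.cast_one]
  ring

theorem t_lt {n : ℕ} (hτ : 0 < G.tau) (hn : 1 ≤ n) : G.t (n - 1) < G.t n := by
  rw [t_eq_add hn]
  linarith

theorem Icc_t_subset {n : ℕ} (hT : 0 < G.T) (hn : n ∈ Finset.Icc 1 G.N) :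
    Icc (G.t (n - 1)) (G.t n) ⊆ Icc 0 G.T := by
  obtain ⟨hn1, hnN⟩ := Finset.mem_Icc.1 hn
  have hN : (0 : ℝ) < G.N := by exact_mod_cast hn1.trans hnN
  have hτ : 0 < G.tau := div_pos hT hN
  have h2 : (n : ℝ) ≤ G.N := by exact_mod_cast hnN
  refine Icc_subset_Icc (by unfold t; positivity) ?_
  calc G.t n ≤ G.N * G.tau := by unfold t; gcongr
    _ = G.T := by rw [tau, mul_div_cancel₀ _ hN.ne']

theorem integral_eq_tau_mul {n : ℕ} (hτ : 0 < G.tau) (hn : 1 ≤ n) {g : ℝ → ℝ} {c : ℝ}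
    (hg : ∀ s ∈ Ioo (G.t (n - 1)) (G.t n), g s = c) :
    ∫ s in G.t (n - 1)..G.t n, g s = G.tau * c := by
  rw [intervalIntegral.integral_congr_Ioo_of_le (t_lt hτ hn).le hg, intervalIntegral.integral_const,
    t_eq_add hn, add_sub_cancel_left, smul_eq_mul]

theorem stInt_eq {n : ℕ} (hτ : 0 < G.tau) (hn : 1 ≤ n) {ab : ℝ → E d → ℝ} {c : ℝ}
    (hab : ∀ s ∈ Ioo (G.t (n - 1)) (G.t n), ∫ x in G.Om, ab s x = c) :
    G.stInt n ab = G.tau * c :=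
  integral_eq_tau_mul hτ hn hab

theorem timeAvg_affine {F : Type*} [NormedAddCommGroup F] [NormedSpace ℝ F] [CompleteSpace F]
    {n : ℕ} (hτ : 0 < G.tau) (hn : 1 ≤ n) {g : ℝ → F} {a b : F}
    (hg : ∀ s ∈ Ioo (G.t (n - 1)) (G.t n), g s = a + ((s - G.t (n - 1)) / G.tau) • (b - a)) :
    G.timeAvg n g = (1 / 2 : ℝ) • (a + b) := by
  have h1 : ∫ s in G.t (n - 1)..G.t n, (s - G.t (n - 1)) / G.tau = G.tau / 2 := by
    rw [intervalIntegral.integral_div, intervalIntegral.integral_sub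
      intervalIntegral.intervalIntegrable_id intervalIntegrable_const, integral_id,
      intervalIntegral.integral_const, t_eq_add hn, smul_eq_mul]
    field_simp
    ring
  rw [timeAvg, intervalIntegral.integral_congr_Ioo_of_le (t_lt hτ hn).le hg, intervalIntegral.integral_add
    intervalIntegrable_const (Continuous.intervalIntegrable (by fun_prop) _ _),
    intervalIntegral.integral_const, intervalIntegral.integral_smul_const, h1, t_eq_add hn,
    add_sub_cancel_left, smul_add, smul_smul, smul_smul, inv_mul_cancel₀ hτ.ne']
  have h2 : G.tau⁻¹ * (G.tau / 2) = 1 / 2 := by field_simp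
  rw [h2]
  module

/-- The function `u` of time is affine on `[tⁿ⁻¹, tⁿ]` with the end values `a` and `b`. -/
def AffineStep {X : Type*} [AddCommGroup X] [Module ℝ X] (G : Grid d) (n : ℕ) (u : ℝ → X)
    (a b : X) : Prop :=
  ∀ s ∈ Icc (G.t (n - 1)) (G.t n), u s = a + ((s - G.t (n - 1)) / G.tau) • (b - a)

theorem AffineStep.dt_eq {n : ℕ} {u : ℝ → G.Vh} {a b : G.Vh} (hu : AffineStep G n u a b)
    {s : ℝ} (hs : s ∈ Ioo (G.t (n - 1)) (G.t n)) (x : E d) :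
    G.dt u s x = G.tau⁻¹ * (b.1 x - a.1 x) := by
  have h1 : (fun s' => (u s').1 x) =ᶠ[nhds s]
      fun s' => a.1 x + (s' - G.t (n - 1)) / G.tau * (b.1 x - a.1 x) := by
    filter_upwards [isOpen_Ioo.mem_nhds hs] with s' hs'
    rw [hu s' (Ioo_subset_Icc_self hs')]
    rfl
  have h2 : HasDerivAt (fun s' => a.1 x + (s' - G.t (n - 1)) / G.tau * (b.1 x - a.1 x))
      (1 / G.tau * (b.1 x - a.1 x)) s :=
    ((((hasDerivAt_id s).sub_const _).div_const _).mul_const _).const_add _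
  rw [dt, h1.deriv_eq, h2.deriv, one_div]

theorem AffineStep.bar_eq {n : ℕ} (hτ : 0 < G.tau) (hn : 1 ≤ n) {u : ℝ → G.Vh} {a b : G.Vh}
    (hu : AffineStep G n u a b) : G.bar u n = ((1 / 2 : ℝ) • (a + b)).1 := by
  ext x
  refine timeAvg_affine hτ hn (a := a.1 x) (b := b.1 x) fun s hs => ?_
  rw [hu s (Ioo_subset_Icc_self hs)]
  rfl

theorem AffineStep.gradient_bar {n : ℕ} (hτ : 0 < G.tau) (hn : 1 ≤ n) {u : ℝ → G.Vh}
    {a b : G.Vh} (hu : AffineStep G n u a b) {x : E d} (hx : x ∈ G.cellInteriors) :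
    gradient (G.bar u n) x = (1 / 2 : ℝ) • (gradient a.1 x + gradient b.1 x) := by
  rw [hu.bar_eq hτ hn, gradient_smul_of_mem _ _ hx, gradient_add_of_mem _ _ hx]

/-- Inside cells, averaging the gradient and differentiating the average (`AffineStep.gradient_bar`)
give the same midpoint, so the scheme and the dissipation evaluate the mobility at the same state
almost everywhere. -/
theorem AffineStep.barGrad_eq {n : ℕ} (hτ : 0 < G.tau) (hn : 1 ≤ n) {u : ℝ → G.Vh}
    {a b : G.Vh} (hu : AffineStep G n u a b) {x : E d} (hx : x ∈ G.cellInteriors) :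
    G.barGrad u n x = (1 / 2 : ℝ) • (gradient a.1 x + gradient b.1 x) := by
  refine timeAvg_affine hτ hn fun s hs => ?_
  have h1 : gradient (b - a).1 x = gradient b.1 x - gradient a.1 x :=
    congrArg Prod.snd (jet_sub_of_mem b a hx)
  rw [hu s (Ioo_subset_Icc_self hs), gradient_add_of_mem _ _ hx, gradient_smul_of_mem _ _ hx, h1]

/-- Fubini, followed by the substitution `s = tⁿ⁻¹ + θ τ`, turns the time integral at each point
into a segment average. -/
theorem stInt_comp_affine (hG : G.IsMesh h) {n : ℕ} (hτ : 0 < G.tau) (hn : 1 ≤ n)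
    {g : ℝ → ℝ → ℝ} (hg : Continuous fun p : ℝ × ℝ => g p.1 p.2) {ρ η : ℝ → G.Vh}
    {r₀ r₁ e₀ e₁ : G.Vh} (hρ : AffineStep G n ρ r₀ r₁) (hη : AffineStep G n η e₀ e₁)
    (w : G.Vh) :
    G.stInt n (fun s x => g ((ρ s).1 x) ((η s).1 x) * w.1 x)
      = G.tau * ∫ x in G.Om, segAvg g (r₀.1 x) (r₁.1 x) (e₀.1 x) (e₁.1 x) * w.1 x := by
  let H : ℝ → E d → ℝ := fun s x =>
    g (r₀.1 x + (s - G.t (n - 1)) / G.tau * (r₁.1 x - r₀.1 x))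
      (e₀.1 x + (s - G.t (n - 1)) / G.tau * (e₁.1 x - e₀.1 x)) * w.1 x
  have hH : Continuous (Function.uncurry H) := by
    have h1 := r₀.2.1
    have h2 := r₁.2.1
    have h3 := e₀.2.1
    have h4 := e₁.2.1
    have h5 := w.2.1
    refine Continuous.mul (hg.comp (f := fun p : ℝ × E d =>
      (r₀.1 p.2 + (p.1 - G.t (n - 1)) / G.tau * (r₁.1 p.2 - r₀.1 p.2),
        e₀.1 p.2 + (p.1 - G.t (n - 1)) / G.tau * (e₁.1 p.2 - e₀.1 p.2))) ?_) (by fun_prop)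
    fun_prop
  have hswap : ∫ s in G.t (n - 1)..G.t n, ∫ x in G.Om, H s x
      = ∫ x in G.Om, ∫ s in G.t (n - 1)..G.t n, H s x := by
    simp only [intervalIntegral.integral_of_le (t_lt hτ hn).le]
    refine integral_integral_swap ?_
    rw [Measure.prod_restrict]
    exact (hH.continuousOn.integrableOn_compact (isCompact_Icc.prod (isCompact_Om hG))).mono_set
      (prod_mono Ioc_subset_Icc_self subset_rfl)
  have h1 : G.stInt n (fun s x => g ((ρ s).1 x) ((η s).1 x) * w.1 x)
      = ∫ s in G.t (n - 1)..G.t n, ∫ x in G.Om, H s x := by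
    refine intervalIntegral.integral_congr_Ioo_of_le (t_lt hτ hn).le fun s hs => ?_
    simp only [hρ s (Ioo_subset_Icc_self hs), hη s (Ioo_subset_Icc_self hs)]
    rfl
  rw [h1, hswap, ← integral_const_mul]
  congr 1
  ext x
  have h2 := intervalIntegral.smul_integral_comp_mul_add (a := 0) (b := 1)
    (fun s => H s x) G.tau (G.t (n - 1))
  rw [mul_zero, zero_add, mul_one, add_comm G.tau, ← t_eq_add hn, smul_eq_mul] at h2
  rw [← h2, segAvg, ← intervalIntegral.integral_mul_const]
  congr 1
  refine intervalIntegral.integral_congr fun θ _ => ?_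
  simp only [H, add_sub_cancel_right, mul_div_cancel_left₀ _ hτ.ne']

/-- The time-dependent functions take the values `W` on the `n`-th time interval. -/
structure HasFields (G : Grid d) (n : ℕ) (ρ η μρ μη : ℝ → G.Vh) (W : Fin 6 → G.Vh) : Prop where
  rho : AffineStep G n ρ (W 0) (W 1)
  eta : AffineStep G n η (W 2) (W 3)
  muRho : ∀ s ∈ Ioo (G.t (n - 1)) (G.t n), μρ s = W 4
  muEta : ∀ s ∈ Ioo (G.t (n - 1)) (G.t n), μη s = W 5

variable {n : ℕ} {ρ η μρ μη : ℝ → G.Vh} {W : Fin 6 → G.Vh}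

theorem HasFields.barState_eq (hτ : 0 < G.tau) (hn : 1 ≤ n) (hW : HasFields G n ρ η μρ μη W)
    {x : E d} (hx : x ∈ G.cellInteriors) :
    G.barState ρ η n x = midState fun i => jet (W i) x := by
  simp only [barState, hW.rho.bar_eq hτ hn, hW.eta.bar_eq hτ hn, hW.rho.barGrad_eq hτ hn hx,
    hW.eta.barGrad_eq hτ hn hx]
  rfl

theorem HasFields.mass_eq (hG : G.IsMesh h) (hL : M.GoodMobility) (hτ : 0 < G.tau) (hn : 1 ≤ n)
    (hW : HasFields G n ρ η μρ μη W) (v : G.Vh) :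
    G.stInt n (fun s x => G.dt ρ s x * v.1 x)
      + G.stInt n (fun s x => inner ℝ
          (M.L11 (G.barState ρ η n x) (gradient (μρ s).1 x)
            + (μη s).1 x • M.L12 (G.barState ρ η n x))
          (gradient v.1 x)) = massForm hG hL G.tau W v := by
  rw [massForm, jetForm_eq_add, stInt_eq hτ hn
    (c := ∫ x in G.Om, G.tau⁻¹ * (((W 1).1 x - (W 0).1 x) * v.1 x)), integral_const_mul,
    mul_inv_cancel_left₀ hτ.ne', stInt_eq hτ hn (c := ∫ x in G.Om, inner ℝ
      (M.L11 (midState fun i => jet (W i) x) (gradient (W 4).1 x)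
        + (W 5).1 x • M.L12 (midState fun i => jet (W i) x)) (gradient v.1 x)),
    ← integral_const_mul]
  · simp only [ContinuousMap.coe_mk, real_inner_smul_left]
    rfl
  · intro s hs
    refine integral_congr_ae ?_
    filter_upwards [ae_mem_cellInteriors hG] with x hx
    rw [hW.barState_eq hτ hn hx, hW.muRho s hs, hW.muEta s hs]
  · intro s hs
    simp only [hW.rho.dt_eq hs, mul_assoc]

theorem HasFields.order_eq (hG : G.IsMesh h) (hL : M.GoodMobility) (hτ : 0 < G.tau) (hn : 1 ≤ n)
    (hW : HasFields G n ρ η μρ μη W) (v : G.Vh) :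
    G.stInt n (fun s x => G.dt η s x * v.1 x)
      + G.stInt n (fun s x =>
          (inner ℝ (M.L12 (G.barState ρ η n x)) (gradient (μρ s).1 x)
            + M.L22 (G.barState ρ η n x) * (μη s).1 x) * v.1 x)
      = orderForm hG hL G.tau W v := by
  have hI1 : IntegrableOn (fun x => ((W 3).1 x - (W 2).1 x) * v.1 x) G.Om :=
    ((((W 3).2.1.sub (W 2).2.1).mul v.2.1).continuousOn).integrableOn_compact (isCompact_Om hG)
  have hI2 : IntegrableOn (fun x => G.tau * ((inner ℝ (M.L12 (midState fun i => jet (W i) x))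
      (gradient (W 4).1 x) + M.L22 (midState fun i => jet (W i) x) * (W 5).1 x) * v.1 x)) G.Om := by
    have h1 := continuous_reaction (d := d) hL
    exact (integrableOn_comp_jet hG (Φ := fun p : Option (Fin 6) → ℝ × E d =>
      (inner ℝ (M.L12 (midState fun i => p (some i))) (p (some 4)).2
        + M.L22 (midState fun i => p (some i)) * (p (some 5)).1) * (p none).1)
      ((h1.comp (f := fun (p : Option (Fin 6) → ℝ × E d) i => p (some i)) (by fun_prop)).mul
        (by fun_prop)) (fun i => i.elim v W)).const_mul G.tau
  rw [orderForm, jetForm_apply, stInt_eq hτ hn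
    (c := ∫ x in G.Om, G.tau⁻¹ * (((W 3).1 x - (W 2).1 x) * v.1 x)), integral_const_mul,
    mul_inv_cancel_left₀ hτ.ne', stInt_eq hτ hn (c := ∫ x in G.Om,
      (inner ℝ (M.L12 (midState fun i => jet (W i) x)) (gradient (W 4).1 x)
        + M.L22 (midState fun i => jet (W i) x) * (W 5).1 x) * v.1 x),
    ← integral_const_mul, ← integral_add hI1 hI2]
  · refine integral_congr_ae (Filter.Eventually.of_forall fun x => ?_)
    simp only [ContinuousMap.coe_mk, inner_zero_left, jet]
    ring
  · intro s hs
    refine integral_congr_ae ?_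
    filter_upwards [ae_mem_cellInteriors hG] with x hx
    rw [hW.barState_eq hτ hn hx, hW.muRho s hs, hW.muEta s hs]
  · intro s hs
    simp only [hW.eta.dt_eq hs, mul_assoc]

/-- Covers both chemical potentials: `u` is the field whose averaged gradient enters, `g` the
partial derivative of `f`. The minus sign matches the forms being negative residuals. -/
theorem stInt_potential_eq (hG : G.IsMesh h) (hτ : 0 < G.tau) (hn : 1 ≤ n) {g : ℝ → ℝ → ℝ}
    (hg : Continuous fun p : ℝ × ℝ => g p.1 p.2) (γ : ℝ) {r₀ r₁ e₀ e₁ a b m : G.Vh}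
    {u μ : ℝ → G.Vh} (hρ : AffineStep G n ρ r₀ r₁) (hη : AffineStep G n η e₀ e₁)
    (hu : AffineStep G n u a b) (hμ : ∀ s ∈ Ioo (G.t (n - 1)) (G.t n), μ s = m) (w : G.Vh) :
    G.stInt n (fun s x => (μ s).1 x * w.1 x)
      - γ * G.stInt n (fun _ x => inner ℝ (gradient (G.bar u n) x) (gradient w.1 x))
      - G.stInt n (fun s x => g ((ρ s).1 x) ((η s).1 x) * w.1 x)
      = -(G.tau * ∫ x in G.Om,
        ((segAvg g (r₀.1 x) (r₁.1 x) (e₀.1 x) (e₁.1 x) - m.1 x) * w.1 x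
          + inner ℝ (γ • (1 / 2 : ℝ) • (gradient a.1 x + gradient b.1 x)) (gradient w.1 x))) := by
  have hI1 : IntegrableOn (fun x =>
      segAvg g (r₀.1 x) (r₁.1 x) (e₀.1 x) (e₁.1 x) * w.1 x) G.Om :=
    ((continuous_segAvg hg r₀.2.1 r₁.2.1 e₀.2.1 e₁.2.1).mul w.2.1).continuousOn.integrableOn_compact
      (isCompact_Om hG)
  have hI2 : IntegrableOn (fun x => m.1 x * w.1 x) G.Om :=
    (m.2.1.mul w.2.1).continuousOn.integrableOn_compact (isCompact_Om hG)
  have hI3 : IntegrableOn (fun x => γ * inner ℝ ((1 / 2 : ℝ) • (gradient a.1 x + gradient b.1 x))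
      (gradient w.1 x)) G.Om :=
    integrableOn_comp_jet hG (ι := Fin 3)
      (Φ := fun p => γ * inner ℝ ((1 / 2 : ℝ) • ((p 0).2 + (p 1).2)) (p 2).2) (by fun_prop)
      ![a, b, w]
  rw [stInt_comp_affine hG hτ hn hg hρ hη, stInt_eq hτ hn (c := ∫ x in G.Om, m.1 x * w.1 x),
    stInt_eq hτ hn (c := ∫ x in G.Om,
      inner ℝ ((1 / 2 : ℝ) • (gradient a.1 x + gradient b.1 x)) (gradient w.1 x))]
  · have h1 : ∀ x, (segAvg g (r₀.1 x) (r₁.1 x) (e₀.1 x) (e₁.1 x) - m.1 x) * w.1 x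
        + inner ℝ (γ • (1 / 2 : ℝ) • (gradient a.1 x + gradient b.1 x)) (gradient w.1 x)
        = (segAvg g (r₀.1 x) (r₁.1 x) (e₀.1 x) (e₁.1 x) * w.1 x - m.1 x * w.1 x)
          + γ * inner ℝ ((1 / 2 : ℝ) • (gradient a.1 x + gradient b.1 x)) (gradient w.1 x) :=
      fun x => by rw [real_inner_smul_left]; ring
    simp only [h1]
    have hI12 : IntegrableOn (fun x => segAvg g (r₀.1 x) (r₁.1 x) (e₀.1 x) (e₁.1 x) * w.1 x
      - m.1 x * w.1 x) G.Om := hI1.sub hI2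
    rw [integral_add hI12 hI3, integral_sub hI1 hI2, integral_const_mul]
    ring
  · intro s _
    refine integral_congr_ae ?_
    filter_upwards [ae_mem_cellInteriors hG] with x hx
    rw [hu.gradient_bar hτ hn hx]
  · intro s hs
    rw [hμ s hs]

theorem HasFields.potRho_eq (hG : G.IsMesh h) (hf : M.GoodPotential) (hτ : 0 < G.tau)
    (hn : 1 ≤ n) (hW : HasFields G n ρ η μρ μη W) (w : G.Vh) :
    G.stInt n (fun s x => (μρ s).1 x * w.1 x)
      - M.gammaRho * G.stInt n (fun _ x => inner ℝ (gradient (G.bar ρ n) x) (gradient w.1 x))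
      - G.stInt n (fun s x => M.fRho ((ρ s).1 x) ((η s).1 x) * w.1 x)
      = -(G.tau * potRhoForm hG hf W w) :=
  stInt_potential_eq hG hτ hn hf.continuous_fRho _ hW.rho hW.eta hW.rho hW.muRho w

theorem HasFields.potEta_eq (hG : G.IsMesh h) (hf : M.GoodPotential) (hτ : 0 < G.tau)
    (hn : 1 ≤ n) (hW : HasFields G n ρ η μρ μη W) (w : G.Vh) :
    G.stInt n (fun s x => (μη s).1 x * w.1 x)
      - M.gammaEta * G.stInt n (fun _ x => inner ℝ (gradient (G.bar η n) x) (gradient w.1 x))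
      - G.stInt n (fun s x => M.fEta ((ρ s).1 x) ((η s).1 x) * w.1 x)
      = -(G.tau * potEtaForm hG hf W w) :=
  stInt_potential_eq hG hτ hn hf.continuous_fEta _ hW.rho hW.eta hW.eta hW.muEta w

theorem HasFields.integral_dissipation (hG : G.IsMesh h) (hτ : 0 < G.tau) (hn : 1 ≤ n)
    (hW : HasFields G n ρ η μρ μη W) :
    ∫ s in G.t (n - 1)..G.t n, G.dissipation M (G.bar ρ n) (G.bar η n) (μρ s).1 (μη s).1
      = G.tau * ∫ x in G.Om, dissipationDensity M fun i => jet (W i) x := by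
  refine integral_eq_tau_mul hτ hn fun s hs => ?_
  refine integral_congr_ae ?_
  filter_upwards [ae_mem_cellInteriors hG] with x hx
  simp only [hW.muRho s hs, hW.muEta s hs, hW.rho.bar_eq hτ hn, hW.eta.bar_eq hτ hn,
    gradient_smul_of_mem _ _ hx, gradient_add_of_mem _ _ hx]
  rfl

end Time

/-! ### From solutions of the scheme to time steps: energy law and mass conservation. -/

theorem IsContPiecewisePoly.affineStep {u : ℝ → G.Vh} (hu : G.IsContPiecewisePoly 1 u)
    (hT : 0 < G.T) (hτ : 0 < G.tau) {n : ℕ} (hn : n ∈ Finset.Icc 1 G.N) :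
    AffineStep G n u (u (G.t (n - 1))) (u (G.t n)) := by
  have hn1 := (Finset.mem_Icc.1 hn).1
  have hlt := t_lt hτ hn1
  obtain ⟨c, hc⟩ := hu.1 n hn
  have hIcc : ∀ s ∈ Icc (G.t (n - 1)) (G.t n), u s = c 0 + s • c 1 := by
    have h1 : EqOn u (fun s => c 0 + s • c 1) (Ioo (G.t (n - 1)) (G.t n)) := fun s hs => by
      simp [hc s hs, Fin.sum_univ_two]
    -- The polynomial formula is given on the open interval only; continuity extends it to the end
    -- points, which adjacent intervals share.
    exact h1.of_subset_closure (hu.2.mono (Icc_t_subset hT hn)) (by fun_prop) Ioo_subset_Icc_self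
      (closure_Ioo hlt.ne).ge
  intro s hs
  rw [hIcc s hs, hIcc _ (left_mem_Icc.2 hlt.le), hIcc _ (right_mem_Icc.2 hlt.le)]
  have h2 : (s - G.t (n - 1)) / G.tau * (G.t n - G.t (n - 1)) = s - G.t (n - 1) := by
    rw [t_eq_add hn1, add_sub_cancel_left, div_mul_cancel₀ _ hτ.ne']
  have h3 : c 0 + G.t n • c 1 - (c 0 + G.t (n - 1) • c 1) = (G.t n - G.t (n - 1)) • c 1 := by
    module
  rw [h3, smul_smul, h2]
  module

theorem AffineStep.exists_coeff {X : Type*} [AddCommGroup X] [Module ℝ X] {n : ℕ} {u : ℝ → X}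
    {a b : X} (hu : AffineStep G n u a b) : ∃ c : Fin 2 → X,
      ∀ s ∈ Ioo (G.t (n - 1)) (G.t n), u s = ∑ j : Fin 2, s ^ (j : ℕ) • c j := by
  refine ⟨![a - (G.t (n - 1) / G.tau) • (b - a), G.tau⁻¹ • (b - a)], fun s hs => ?_⟩
  rw [hu s (Ioo_subset_Icc_self hs), Fin.sum_univ_two]
  simp only [Fin.val_zero, Fin.val_one, pow_zero, pow_one, one_smul, Matrix.cons_val_zero,
    Matrix.cons_val_one, sub_div]
  module

variable {ρ₀ η₀ : G.Vh} {ρ η μρ μη : ℝ → G.Vh}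

theorem IsSolution.exists_hasFields (hsol : G.IsSolution M ρ₀ η₀ ρ η μρ μη)
    (hT : 0 < G.T) (hτ : 0 < G.tau) {n : ℕ} (hn : n ∈ Finset.Icc 1 G.N) :
    ∃ m k, HasFields G n ρ η μρ μη
      ![ρ (G.t (n - 1)), ρ (G.t n), η (G.t (n - 1)), η (G.t n), m, k] := by
  obtain ⟨c, hc⟩ := hsol.muRho_space n hn
  obtain ⟨c', hc'⟩ := hsol.muEta_space n hn
  refine ⟨c 0, c' 0, hsol.rho_space.affineStep hT hτ hn, hsol.eta_space.affineStep hT hτ hn,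
    fun s hs => ?_, fun s hs => ?_⟩
  · simpa using hc s hs
  · simpa using hc' s hs

/-- Used in both directions: to read off the energy and mass laws of a given solution, and to verify
the scheme for the constructed one. -/
theorem HasFields.isStep_iff (hG : G.IsMesh h) (hL : M.GoodMobility) (hf : M.GoodPotential)
    (hτ : 0 < G.tau) {n : ℕ} (hn : 1 ≤ n) {W : Fin 6 → G.Vh}
    (hW : HasFields G n ρ η μρ μη W) : IsStep hG hL hf G.tau W ↔
    (∀ v : G.Vh,
      G.stInt n (fun s x => G.dt ρ s x * v.1 x)
        + G.stInt n (fun s x => inner ℝ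
            (M.L11 (G.barState ρ η n x) (gradient (μρ s).1 x)
              + (μη s).1 x • M.L12 (G.barState ρ η n x))
            (gradient v.1 x)) = 0) ∧
    (∀ v : G.Vh,
      G.stInt n (fun s x => G.dt η s x * v.1 x)
        + G.stInt n (fun s x =>
            (inner ℝ (M.L12 (G.barState ρ η n x)) (gradient (μρ s).1 x)
              + M.L22 (G.barState ρ η n x) * (μη s).1 x) * v.1 x) = 0) ∧
    (∀ w : G.Vh,
      G.stInt n (fun s x => (μρ s).1 x * w.1 x)
        - M.gammaRho * G.stInt n (fun _ x => inner ℝ (gradient (G.bar ρ n) x) (gradient w.1 x))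
        - G.stInt n (fun s x => M.fRho ((ρ s).1 x) ((η s).1 x) * w.1 x) = 0) ∧
    ∀ w : G.Vh,
      G.stInt n (fun s x => (μη s).1 x * w.1 x)
        - M.gammaEta * G.stInt n (fun _ x => inner ℝ (gradient (G.bar η n) x) (gradient w.1 x))
        - G.stInt n (fun s x => M.fEta ((ρ s).1 x) ((η s).1 x) * w.1 x) = 0 := by
  simp only [hW.mass_eq hG hL hτ hn, hW.order_eq hG hL hτ hn, hW.potRho_eq hG hf hτ hn,
    hW.potEta_eq hG hf hτ hn, neg_eq_zero, mul_eq_zero, hτ.ne', false_or]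
  exact ⟨fun H => ⟨fun v => by rw [H.mass]; rfl, fun v => by rw [H.order]; rfl,
    fun v => by rw [H.potRho]; rfl, fun v => by rw [H.potEta]; rfl⟩,
    fun H => ⟨LinearMap.ext H.1, LinearMap.ext H.2.1, LinearMap.ext H.2.2.1,
      LinearMap.ext H.2.2.2⟩⟩

theorem IsSolution.exists_isStep_hasFields (hG : G.IsMesh h) (hL : M.GoodMobility)
    (hf : M.GoodPotential) (hsol : G.IsSolution M ρ₀ η₀ ρ η μρ μη)
    (hT : 0 < G.T) (hτ : 0 < G.tau) {n : ℕ} (hn : n ∈ Finset.Icc 1 G.N) :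
    ∃ W, W 0 = ρ (G.t (n - 1)) ∧ W 1 = ρ (G.t n) ∧ W 2 = η (G.t (n - 1)) ∧ W 3 = η (G.t n) ∧
      HasFields G n ρ η μρ μη W ∧ IsStep hG hL hf G.tau W := by
  obtain ⟨m, k, hW⟩ := hsol.exists_hasFields hT hτ hn
  exact ⟨_, rfl, rfl, rfl, rfl, hW, (hW.isStep_iff hG hL hf hτ (Finset.mem_Icc.1 hn).1).2
    ⟨hsol.eq1 n hn, hsol.eq2 n hn, hsol.eq3 n hn, hsol.eq4 n hn⟩⟩

theorem IsSolution.energy_sub (hG : G.IsMesh h) (hL : M.GoodMobility) (hf : M.GoodPotential)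
    (hsol : G.IsSolution M ρ₀ η₀ ρ η μρ μη) (hT : 0 < G.T) (hτ : 0 < G.tau) {n : ℕ}
    (hn : n ∈ Finset.Icc 1 G.N) :
    G.energy M (ρ (G.t n)).1 (η (G.t n)).1 - G.energy M (ρ (G.t (n - 1))).1 (η (G.t (n - 1))).1
      = -∫ s in G.t (n - 1)..G.t n,
          G.dissipation M (G.bar ρ n) (G.bar η n) (μρ s).1 (μη s).1 := by
  obtain ⟨W, h0, h1, h2, h3, hW, hstep⟩ := hsol.exists_isStep_hasFields hG hL hf hT hτ hn
  rw [hW.integral_dissipation hG hτ (Finset.mem_Icc.1 hn).1, ← h0, ← h1, ← h2, ← h3,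
    hstep.energy_sub]

theorem IsSolution.mean_t (hG : G.IsMesh h) (hL : M.GoodMobility) (hf : M.GoodPotential)
    (hsol : G.IsSolution M ρ₀ η₀ ρ η μρ μη) (hT : 0 < G.T) (hτ : 0 < G.tau) {n : ℕ}
    (hn : n ≤ G.N) : meanForm hG (ρ (G.t n)) = meanForm hG ρ₀ := by
  induction n with
  | zero => rw [show G.t 0 = 0 by simp [t], hsol.rho_init]
  | succ n ih =>
    obtain ⟨W, h0, h1, -, -, -, hstep⟩ := hsol.exists_isStep_hasFields hG hL hf hT hτ
      (n := n + 1) (Finset.mem_Icc.2 ⟨Nat.le_add_left 1 n, hn⟩)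
    have h2 := massForm_oneVh hG hL G.tau W
    rw [hstep.mass, LinearMap.zero_apply, h0, h1] at h2
    rw [← ih (Nat.le_of_succ_le hn)]
    exact (sub_eq_zero.1 h2.symm)

theorem mem_Ioc_t_ceil (hτ : 0 < G.tau) {s : ℝ} (hs : 0 < s) :
    1 ≤ ⌈s / G.tau⌉₊ ∧ s ∈ Ioc (G.t (⌈s / G.tau⌉₊ - 1)) (G.t ⌈s / G.tau⌉₊) := by
  have h1 : 0 < s / G.tau := div_pos hs hτ
  have h2 : 1 ≤ ⌈s / G.tau⌉₊ := Nat.one_le_iff_ne_zero.2 (Nat.ceil_pos.2 h1).ne'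
  obtain ⟨h3, h4⟩ := (Nat.ceil_eq_iff (Nat.one_le_iff_ne_zero.1 h2)).1 (rfl : ⌈s / G.tau⌉₊ = _)
  refine ⟨h2, ?_, ?_⟩
  · rwa [lt_div_iff₀ hτ] at h3
  · rwa [div_le_iff₀ hτ] at h4

/-- Between grid points the mean is affine in time, and its two end values agree. -/
theorem IsSolution.mean_eq (hG : G.IsMesh h) (hL : M.GoodMobility) (hf : M.GoodPotential)
    (hsol : G.IsSolution M ρ₀ η₀ ρ η μρ μη) (hT : 0 < G.T) (hτ : 0 < G.tau) {s : ℝ}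
    (hs : s ∈ Icc 0 G.T) (hN : 1 ≤ G.N) : meanForm hG (ρ s) = meanForm hG ρ₀ := by
  rcases hs.1.eq_or_lt with rfl | hs0
  · rw [hsol.rho_init]
  · obtain ⟨hn1, hmem⟩ := mem_Ioc_t_ceil hτ hs0
    have hnN : ⌈s / G.tau⌉₊ ≤ G.N := by
      have hNpos : (0 : ℝ) < G.N := by exact_mod_cast hN
      refine Nat.ceil_le.2 ?_
      rw [div_le_iff₀ hτ, tau, mul_div_cancel₀ _ hNpos.ne']
      exact hs.2
    rw [hsol.rho_space.affineStep hT hτ (Finset.mem_Icc.2 ⟨hn1, hnN⟩) s (Ioc_subset_Icc_self hmem),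
      map_add, map_smul, map_sub, hsol.mean_t hG hL hf hT hτ hnN,
      hsol.mean_t hG hL hf hT hτ ((Nat.sub_le _ _).trans hnN), sub_self, smul_zero, add_zero]

/-! ### Gluing the time steps. -/

/-- The continuous piecewise affine interpolation in time of the values `a 0, …, a N`. -/
def interpolation {X : Type*} [AddCommGroup X] [Module ℝ X] (G : Grid d) (a : ℕ → X) (s : ℝ) : X :=
  a 0 + ∑ i ∈ Finset.range G.N, max 0 (min ((s - G.t i) / G.tau) 1) • (a (i + 1) - a i)

theorem affineStep_interpolation {X : Type*} [AddCommGroup X] [Module ℝ X] (hτ : 0 < G.tau)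
    (a : ℕ → X) {n : ℕ} (hn : n + 1 ≤ G.N) :
    AffineStep G (n + 1) (interpolation G a) (a n) (a (n + 1)) := by
  intro s hs
  rw [Nat.add_sub_cancel] at hs ⊢
  -- On the current interval the clamped weights of earlier increments are saturated at one, the
  -- current weight is linear, and later ones vanish; the saturated part telescopes.
  have hge : ∀ i, i < n → max 0 (min ((s - G.t i) / G.tau) 1) = 1 := by
    intro i hi
    have h1 : (i : ℝ) + 1 ≤ n := by exact_mod_cast hi
    have h2 : 1 ≤ (s - G.t i) / G.tau := by
      rw [le_div_iff₀ hτ]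
      have := hs.1
      unfold t at this ⊢
      nlinarith
    rw [min_eq_right h2, max_eq_right zero_le_one]
  have heq : max 0 (min ((s - G.t n) / G.tau) 1) = (s - G.t n) / G.tau := by
    have h1 : 0 ≤ (s - G.t n) / G.tau := div_nonneg (sub_nonneg.2 hs.1) hτ.le
    have h2 : (s - G.t n) / G.tau ≤ 1 := by
      rw [div_le_iff₀ hτ]
      have := hs.2
      unfold t at this ⊢
      push_cast at this
      linarith
    rw [min_eq_left h2, max_eq_right h1]
  have hle : ∀ i, n < i → max 0 (min ((s - G.t i) / G.tau) 1) = 0 := by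
    intro i hi
    have h1 : (n : ℝ) + 1 ≤ i := by exact_mod_cast hi
    have h2 : (s - G.t i) / G.tau ≤ 0 := by
      refine div_nonpos_of_nonpos_of_nonneg ?_ hτ.le
      have := hs.2
      unfold t at this ⊢
      push_cast at this
      nlinarith
    exact max_eq_left ((min_le_left _ _).trans h2)
  have hsum : ∑ i ∈ Finset.range (n + 1), max 0 (min ((s - G.t i) / G.tau) 1) • (a (i + 1) - a i)
      = ∑ i ∈ Finset.range G.N, max 0 (min ((s - G.t i) / G.tau) 1) • (a (i + 1) - a i) := by
    refine Finset.sum_subset (Finset.range_subset_range.2 hn) fun i _ hi => ?_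
    rw [hle i (by simpa using hi), zero_smul]
  rw [interpolation, ← hsum, Finset.sum_range_succ, heq]
  have htel : ∑ i ∈ Finset.range n, max 0 (min ((s - G.t i) / G.tau) 1) • (a (i + 1) - a i)
      = a n - a 0 := by
    rw [← Finset.sum_range_sub]
    refine Finset.sum_congr rfl fun i hi => ?_
    rw [hge i (Finset.mem_range.1 hi), one_smul]
  rw [htel]
  abel

theorem isContPiecewisePoly_interpolation {X : Type*} [AddCommGroup X] [Module ℝ X]
    [TopologicalSpace X] [IsTopologicalAddGroup X] [ContinuousSMul ℝ X] (hτ : 0 < G.tau)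
    (a : ℕ → X) : G.IsContPiecewisePoly 1 (interpolation G a) := by
  refine ⟨fun n hn => ?_, ?_⟩
  · obtain ⟨hn1, hnN⟩ := Finset.mem_Icc.1 hn
    obtain ⟨m, rfl⟩ := Nat.exists_eq_add_of_le' hn1
    exact (affineStep_interpolation hτ a hnN).exists_coeff
  · unfold interpolation
    fun_prop

theorem exists_isSolution (hG : G.IsMesh h) (hside : 0 < G.side) (hγ : M.PosInterface)
    (hL : M.GoodMobility) (hf : M.GoodPotential) (hτ : 0 < G.tau) (ρ₀ η₀ : G.Vh) :
    ∃ ρ η μρ μη : ℝ → G.Vh, G.IsSolution M ρ₀ η₀ ρ η μρ μη := by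
  choose step hρ hη hstep using
    fun p : G.Vh × G.Vh => exists_isStep hG hside hγ hL hf hτ p.1 p.2
  let val : ℕ → G.Vh × G.Vh := fun n => Nat.rec (ρ₀, η₀) (fun _ p => (step p 1, step p 3)) n
  let ρ := interpolation G fun n => (val n).1
  let η := interpolation G fun n => (val n).2
  -- On the open interval with index `n + 1` the ceiling is `n + 1`, and the potentials there belong
  -- to the step that starts from `val n`.
  let μρ : ℝ → G.Vh := fun s => step (val (⌈s / G.tau⌉₊ - 1)) 4
  let μη : ℝ → G.Vh := fun s => step (val (⌈s / G.tau⌉₊ - 1)) 5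
  have hceil : ∀ n : ℕ, ∀ s ∈ Ioo (G.t (n + 1 - 1)) (G.t (n + 1)), ⌈s / G.tau⌉₊ = n + 1 := by
    intro n s hs
    rw [Nat.ceil_eq_iff n.succ_ne_zero, lt_div_iff₀ hτ, div_le_iff₀ hτ]
    exact ⟨hs.1, hs.2.le⟩
  have hμρ : ∀ n : ℕ, ∀ s ∈ Ioo (G.t (n + 1 - 1)) (G.t (n + 1)), μρ s = step (val n) 4 := by
    intro n s hs
    simp only [μρ, hceil n s hs, Nat.add_sub_cancel]
  have hμη : ∀ n : ℕ, ∀ s ∈ Ioo (G.t (n + 1 - 1)) (G.t (n + 1)), μη s = step (val n) 5 := by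
    intro n s hs
    simp only [μη, hceil n s hs, Nat.add_sub_cancel]
  have hfields : ∀ n : ℕ, n + 1 ≤ G.N → HasFields G (n + 1) ρ η μρ μη (step (val n)) := by
    intro n hn
    refine ⟨?_, ?_, hμρ n, hμη n⟩
    -- `val (n + 1)` unfolds to the end values of `step (val n)`, so only the start value needs
    -- rewriting.
    · rw [hρ (val n)]
      exact affineStep_interpolation hτ (fun n => (val n).1) hn
    · rw [hη (val n)]
      exact affineStep_interpolation hτ (fun n => (val n).2) hn
  have hfields' : ∀ n ∈ Finset.Icc 1 G.N, HasFields G n ρ η μρ μη (step (val (n - 1))) := by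
    intro n hn
    obtain ⟨m, rfl⟩ := Nat.exists_eq_add_of_le' (Finset.mem_Icc.1 hn).1
    exact hfields m (Finset.mem_Icc.1 hn).2
  have heqs := fun (n : ℕ) (hn : n ∈ Finset.Icc 1 G.N) =>
    ((hfields' n hn).isStep_iff hG hL hf hτ (Finset.mem_Icc.1 hn).1).1 (hstep (val (n - 1)))
  have hinit : ∀ a : ℕ → G.Vh, interpolation G a 0 = a 0 := by
    intro a
    rw [interpolation, Finset.sum_eq_zero, add_zero]
    intro i _
    have h1 : (0 - G.t i) / G.tau ≤ 0 := by
      refine div_nonpos_of_nonpos_of_nonneg ?_ hτ.le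
      have : 0 ≤ G.t i := mul_nonneg (Nat.cast_nonneg i) hτ.le
      linarith
    rw [max_eq_left ((min_le_left _ _).trans h1), zero_smul]
  refine ⟨ρ, η, μρ, μη, isContPiecewisePoly_interpolation hτ _,
    isContPiecewisePoly_interpolation hτ _, fun n hn => ?_, fun n hn => ?_, hinit _, hinit _,
    fun n hn => (heqs n hn).1, fun n hn => (heqs n hn).2.1, fun n hn => (heqs n hn).2.2.1,
    fun n hn => (heqs n hn).2.2.2⟩
  · exact ⟨fun _ => step (val (n - 1)) 4, fun s hs => by simp [(hfields' n hn).muRho s hs]⟩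
  · exact ⟨fun _ => step (val (n - 1)) 5, fun s hs => by simp [(hfields' n hn).muEta s hs]⟩

end Grid

end CHAC

end

theorem theorem1 {d : ℕ} (hd : d = 2 ∨ d = 3) (M : Model d) (G : Grid d)
    (hside : 0 < G.side)
    (hA1 : M.PosInterface) (hA2 : M.GoodMobility) (hA3 : M.GoodPotential)
    (h τ : ℝ) (hh : 0 < h) (hA4 : G.IsMesh h)
    (hτ : 0 < τ) (hT : 0 < G.T) (hN : 1 ≤ G.N) (hA5 : τ = G.tau)
    (ρ0 η0 : G.Vh) :
    (∃ ρ η μρ μη : ℝ → G.Vh, G.IsSolution M ρ0 η0 ρ η μρ μη) ∧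
    ∀ ρ η μρ μη : ℝ → G.Vh, G.IsSolution M ρ0 η0 ρ η μρ μη →
      (∀ s ∈ Set.Icc 0 G.T,
        HasDerivWithinAt (fun s' => ∫ x in G.Om, (ρ s').1 x) 0 (Set.Icc 0 G.T) s ∧
        ∫ x in G.Om, (ρ s).1 x = ∫ x in G.Om, ρ0.1 x) ∧
      ∀ n ∈ Finset.Icc 1 G.N,
        G.energy M (ρ (G.t n)).1 (η (G.t n)).1
            - G.energy M (ρ (G.t (n - 1))).1 (η (G.t (n - 1))).1
          = - ∫ s in G.t (n - 1)..G.t n,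
              G.dissipation M (G.bar ρ n) (G.bar η n) (μρ s).1 (μη s).1 := by
  have hτ' : 0 < G.tau := hA5 ▸ hτ
  refine ⟨Grid.exists_isSolution hA4 hside hA1 hA2 hA3 hτ' ρ0 η0, fun ρ η μρ μη hsol => ?_⟩
  have hmean : ∀ s ∈ Set.Icc 0 G.T, ∫ x in G.Om, (ρ s).1 x = ∫ x in G.Om, ρ0.1 x :=
    fun s hs => hsol.mean_eq hA4 hA2 hA3 hT hτ' hs hN
  -- The mass is constant on `[0, T]`, hence has zero derivative within this interval, one-sided at
  -- its ends.
  exact ⟨fun s hs => ⟨(hasDerivWithinAt_const s _ _).congr hmean (hmean s hs), hmean s hs⟩,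
    fun n hn => hsol.energy_sub hA4 hA2 hA3 hT hτ' hn⟩
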